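/- Let $d\in\mathbb N$, let $\mathbb M_0$ be the set of all locally finite counting measures on $\mathbb R^d\times\mathbb R$ (Borel measures with values in $\{0,1,2,\dots,\infty\}$ that are finite on bounded sets), and let $\mathcal M_0$ be the smallest $\sigma$-algebra on $\mathbb M_0$ making all maps $\varphi\mapsto\varphi(S)$, $S$ Borel, measurable. For $x\in\mathbb R^d$ let $T_x:\mathbb M_0\to\mathbb M_0$ be the shift $(T_x\varphi)(B\times L)=\varphi((B+x)\times L)$. Let $\Phi$ be a marked point process, i.e. a measurable map from a probability space $(\Omega,\mathcal A,P)$ to $(\mathbb M_0,\mathcal M_0)$, with law $P^\Phi$. Assume that $\Phi$ is stationary ($P^\Phi$ is invariant under every $T_x$) and ergodic ($P^\Phi(A)\in\{0,1\}$ for every $A\in\mathcal M_0$ with $T_x^{-1}A=A$ for all $x\in\mathbb R^d$). Let $f:\mathbb R^d\times\mathbb R\times\mathbb M_0\to\mathbb R$ be a non-negative measurable function such that $f(t-x,y,T_x\varphi)=f(t,y,\varphi)$ for all $t,x\in\mathbb R^d$, $y\in\mathbb R$, $\varphi\in\mathbb M_0$, and such that $f$ is integrable with respect to the marked Campbell measure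 $$C(B\times L\times M)=\mathbb E\bigl[\Phi((B\cap[0,1]^d)\times L)\,\mathbf 1_M(\Phi)\bigr],\qquad B\in\mathcal B(\mathbb R^d),\ L\in\mathcal B(\mathbb R),\ M\in\mathcal M_0 .$$ Define, with the points of $\varphi$ counted with multiplicity, $$X(\varphi)=\sum_{(t,y)\in\varphi,\ t\in[0,1]^d} f(t,y,\varphi),\qquad X_n(\varphi)=\frac1{n^d}\sum_{(t,y)\in\varphi,\ t\in[0,n]^d} f(t,y,\varphi)\quad(n\ge1).$$ Then $X$ and all $X_n$ are measurable (as functions with values in $[0,\infty]$), $\mathbb E^\Phi X=\int X\,dP^\Phi<\infty$, and $X_n(\varphi)\to\mathbb E^\Phi X$ as $n\to\infty$ for $P^\Phi$-almost every $\varphi\in\mathbb M_0$. -/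

import Mathlib

open MeasureTheory ProbabilityTheory Filter Set
open scoped ENNReal Topology

namespace MPP

/-- A locally finite counting measure on `ℝ^d × ℝ`: a Borel measure which is finite on bounded sets
and takes its values in `{0, 1, 2, …, ∞}`. Points may be multiple. -/
structure IsLocallyFiniteCounting {d : ℕ} (φ : Measure ((Fin d → ℝ) × ℝ)) : Prop where
  lt_top : ∀ B : Set ((Fin d → ℝ) × ℝ), Bornology.IsBounded B → φ B < ∞
  integer : ∀ S : Set ((Fin d → ℝ) × ℝ), MeasurableSet S → φ S = ∞ ∨ ∃ k : ℕ, φ S = k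

/-- The space `𝕄₀` of all locally finite counting measures on `ℝ^d × ℝ` (locations and real marks).
As a subtype of `Measure _` it carries the smallest `σ`-algebra which makes all the evaluations
`φ ↦ φ S`, `S` Borel, measurable. -/
abbrev Config (d : ℕ) : Type :=
  {φ : Measure ((Fin d → ℝ) × ℝ) // IsLocallyFiniteCounting φ}

theorem measurable_translate {d : ℕ} (x : Fin d → ℝ) :
    Measurable (fun p : (Fin d → ℝ) × ℝ => (p.1 - x, p.2)) := by fun_prop

/-- The shift `T_x`, given by `(T_x φ)(B × L) = φ((B + x) × L)`: a point of `φ` at location `t`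
with mark `y` becomes a point of `T_x φ` at location `t - x` with mark `y`. -/
noncomputable def shift {d : ℕ} (x : Fin d → ℝ) (φ : Config d) : Config d :=
  ⟨φ.1.map (fun p => (p.1 - x, p.2)), by
    constructor
    · intro B hB
      have hc : Bornology.IsBounded (closure B) := hB.closure
      refine lt_of_le_of_lt (measure_mono subset_closure) ?_
      rw [Measure.map_apply (measurable_translate x) isClosed_closure.measurableSet]
      refine φ.2.lt_top _ ?_
      have hcomp : IsCompact (closure B) := Metric.isCompact_of_isClosed_isBounded
        isClosed_closure hc
      refine ((hcomp.image (f := fun p : (Fin d → ℝ) × ℝ => (p.1 + x, p.2))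
        (by fun_prop)).isBounded).subset ?_
      intro p hp
      exact ⟨(p.1 - x, p.2), hp, by simp⟩
    · intro S hS
      rw [Measure.map_apply (measurable_translate x) hS]
      exact φ.2.integer _ (measurable_translate x hS)⟩

theorem shift_prod {d : ℕ} (x : Fin d → ℝ) (φ : Config d) {B : Set (Fin d → ℝ)} {L : Set ℝ}
    (hB : MeasurableSet B) (hL : MeasurableSet L) :
    (shift x φ).1 (B ×ˢ L) = φ.1 (((fun t => t + x) '' B) ×ˢ L) := by
  change φ.1.map (fun p => (p.1 - x, p.2)) (B ×ˢ L) = _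
  rw [Measure.map_apply (measurable_translate x) (hB.prod hL)]
  congr 1
  ext ⟨t, y⟩
  simp [sub_eq_add_neg]

theorem measurable_shift {d : ℕ} (x : Fin d → ℝ) : Measurable (shift x) :=
  ((Measure.measurable_map _ (measurable_translate x)).comp measurable_subtype_coe).subtype_mk

/-- Stationarity of a probability law on the configuration space: invariance under all shifts. -/
def IsStationaryLaw {d : ℕ} (Q : Measure (Config d)) : Prop :=
  ∀ x : Fin d → ℝ, Q.map (shift x) = Q

/-- Ergodicity of a probability law on the configuration space: every measurable set which is
invariant under all shifts has probability zero or one. -/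
def IsErgodicLaw {d : ℕ} (Q : Measure (Config d)) : Prop :=
  ∀ A : Set (Config d), MeasurableSet A → (∀ x : Fin d → ℝ, shift x ⁻¹' A = A) →
    Q A = 0 ∨ Q A = 1

/-- The kernel `φ ↦ φ` from configurations to `ℝ^d × ℝ`. -/
noncomputable def pointKernel (d : ℕ) : Kernel (Config d) ((Fin d → ℝ) × ℝ) where
  toFun φ := φ.1
  measurable' := measurable_subtype_coe

/-- A partition of the space into countably many bounded Borel sets. -/
theorem exists_partition (d : ℕ) : ∃ B : ℕ → Set ((Fin d → ℝ) × ℝ),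
    (∀ k, MeasurableSet (B k)) ∧ (∀ k, Bornology.IsBounded (B k)) ∧
    Pairwise (fun i j => Disjoint (B i) (B j)) ∧ ⋃ k, B k = univ := by
  refine ⟨disjointed (fun k : ℕ => Metric.closedBall 0 k), ?_, ?_, ?_, ?_⟩
  · exact MeasurableSet.disjointed fun k => Metric.isClosed_closedBall.measurableSet
  · intro k
    exact Metric.isBounded_closedBall.subset (disjointed_subset _ k)
  · exact disjoint_disjointed _
  · rw [iUnion_disjointed]
    exact Metric.iUnion_closedBall_nat 0

instance instSFinitePointKernel (d : ℕ) : IsSFiniteKernel (pointKernel d) := by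
  classical
  obtain ⟨B, hBm, hBb, hBd, hBu⟩ := exists_partition d
  have hs : ∀ k m : ℕ, MeasurableSet {φ : Config d | φ.1 (B k) = m} := fun k m =>
    ((Measure.measurable_coe (hBm k)).comp measurable_subtype_coe) (measurableSet_singleton _)
  let κ : ℕ × ℕ → Kernel (Config d) ((Fin d → ℝ) × ℝ) := fun i =>
    Kernel.piecewise (hs i.1 i.2) ((pointKernel d).restrict (hBm i.1)) 0
  have hκ : ∀ i, IsFiniteKernel (κ i) := by
    intro i
    refine ⟨⟨(i.2 : ℝ≥0∞), ENNReal.natCast_lt_top _, fun φ => ?_⟩⟩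
    simp only [κ, Kernel.piecewise_apply]
    split_ifs with h
    · rw [Kernel.restrict_apply, Measure.restrict_apply MeasurableSet.univ, univ_inter]
      exact le_of_eq h
    · simp
  have hsum : pointKernel d = Kernel.sum κ := by
    ext φ S hS
    rw [Kernel.sum_apply' _ _ hS, ENNReal.tsum_prod (f := fun k m => κ (k, m) φ S)]
    have h1 : ∀ k, ∑' m, κ (k, m) φ S = φ.1 (S ∩ B k) := by
      intro k
      obtain ⟨m₀, hm₀⟩ : ∃ m : ℕ, φ.1 (B k) = m :=
        (φ.2.integer _ (hBm k)).resolve_left (φ.2.lt_top _ (hBb k)).ne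
      rw [tsum_eq_single m₀]
      · simp only [κ, Kernel.piecewise_apply]
        rw [if_pos (by exact hm₀), Kernel.restrict_apply, Measure.restrict_apply hS]
        rfl
      · intro m hm
        simp only [κ, Kernel.piecewise_apply]
        rw [if_neg]
        · simp
        · intro h
          apply hm
          have h' : φ.1 (B k) = m := h
          rw [hm₀] at h'
          exact (by exact_mod_cast h'.symm)
    simp_rw [h1]
    rw [← measure_iUnion (fun i j hij => (hBd hij).mono inter_subset_right inter_subset_right)
      (fun k => hS.inter (hBm k)), ← inter_iUnion, hBu, inter_univ]
    rfl
  rw [hsum]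
  have := hκ
  infer_instance

/-- The (marked) Campbell measure of a law `Q` on configurations, restricted to locations in the
unit cube: `C(B × L × M) = ∫_M φ((B ∩ [0,1]^d) × L) Q(dφ)`. -/
noncomputable def campbellMeasure {d : ℕ} (Q : Measure (Config d)) :
    Measure ((Fin d → ℝ) × ℝ × Config d) :=
  (Q ⊗ₘ ((pointKernel d).restrict
      (measurableSet_Icc.prod MeasurableSet.univ : MeasurableSet
        (Icc (0 : Fin d → ℝ) 1 ×ˢ (univ : Set ℝ))))).map
    (fun q => (q.2.1, q.2.2, q.1))

/-- `C(B × L × M) = 𝔼[Φ((B ∩ [0,1]^d) × L) 1_M(Φ)]`. -/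
theorem campbellMeasure_prod {d : ℕ} {Ω : Type*} [MeasurableSpace Ω] (P : Measure Ω)
    [IsProbabilityMeasure P] {Φ : Ω → Config d} (hΦ : Measurable Φ)
    {B : Set (Fin d → ℝ)} {L : Set ℝ} {M : Set (Config d)}
    (hB : MeasurableSet B) (hL : MeasurableSet L) (hM : MeasurableSet M) :
    campbellMeasure (P.map Φ) (B ×ˢ L ×ˢ M) =
      ∫⁻ ω, (Φ ω).1 ((B ∩ Icc 0 1) ×ˢ L) * M.indicator 1 (Φ ω) ∂P := by
  have : IsProbabilityMeasure (P.map Φ) := Measure.isProbabilityMeasure_map hΦ.aemeasurable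
  have hBL : MeasurableSet ((B ∩ Icc (0 : Fin d → ℝ) 1) ×ˢ L) :=
    (hB.inter measurableSet_Icc).prod hL
  have hpre : (fun q : Config d × ((Fin d → ℝ) × ℝ) => (q.2.1, q.2.2, q.1)) ⁻¹' (B ×ˢ L ×ˢ M)
      = M ×ˢ (B ×ˢ L) := by
    ext ⟨φ, t, y⟩
    simp only [mem_preimage, mem_prod]
    tauto
  rw [campbellMeasure, Measure.map_apply (by fun_prop) (hB.prod (hL.prod hM)), hpre,
    Measure.compProd_apply_prod hM (hB.prod hL), ← lintegral_indicator hM]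
  have hm : Measurable fun φ : Config d => φ.1 ((B ∩ Icc 0 1) ×ˢ L) * M.indicator 1 φ :=
    ((Measure.measurable_coe hBL).comp measurable_subtype_coe).mul
      (measurable_one.indicator hM)
  rw [← lintegral_map (f := fun φ : Config d => φ.1 ((B ∩ Icc 0 1) ×ˢ L) * M.indicator 1 φ) hm hΦ]
  refine lintegral_congr fun φ => ?_
  by_cases hφ : φ ∈ M
  · simp only [indicator_of_mem hφ, Pi.one_apply, mul_one]
    rw [Kernel.restrict_apply, Measure.restrict_apply (hB.prod hL), prod_inter_prod, inter_univ]
    rfl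
  · simp [indicator_of_notMem hφ]

/-- `∑_{(t,y) ∈ φ, t ∈ W} f(t, y, φ)`, the points of `φ` being counted with their multiplicities
`φ{(t,y)}`; a sum of non-negative terms with values in `[0, ∞]` (for `f ≥ 0`). -/
noncomputable def pointSum {d : ℕ} (f : (Fin d → ℝ) × ℝ × Config d → ℝ)
    (W : Set (Fin d → ℝ)) (φ : Config d) : ℝ≥0∞ :=
  ∑' p : {p : (Fin d → ℝ) × ℝ // p.1 ∈ W},
    φ.1 {p.1} * ENNReal.ofReal (f (p.1.1, p.1.2, φ))

/-- Every `p` which is not a point of `φ` has a neighbourhood without points of `φ`. -/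
theorem exists_nhds_null {d : ℕ} (φ : Config d) (p : (Fin d → ℝ) × ℝ) (hp : φ.1 {p} = 0) :
    ∃ U ∈ 𝓝 p, φ.1 U = 0 := by
  have hanti : Antitone fun n : ℕ => Metric.closedBall p (1 / ((n : ℝ) + 1)) := fun m n h =>
    Metric.closedBall_subset_closedBall (one_div_le_one_div_of_le (by positivity) (by gcongr))
  have hInter : ⋂ n : ℕ, Metric.closedBall p (1 / ((n : ℝ) + 1)) = {p} := by
    ext q
    simp only [mem_iInter, Metric.mem_closedBall, mem_singleton_iff]
    constructor
    · intro h
      refine dist_le_zero.1 (ge_of_tendsto' tendsto_one_div_add_atTop_nhds_zero_nat h)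
    · rintro rfl n
      rw [dist_self]
      positivity
  have hlim := tendsto_measure_iInter_atTop (μ := φ.1)
    (fun n : ℕ => (Metric.isClosed_closedBall (x := p)
      (ε := 1 / ((n : ℝ) + 1))).measurableSet.nullMeasurableSet) hanti
    ⟨0, (φ.2.lt_top _ Metric.isBounded_closedBall).ne⟩
  rw [hInter, hp] at hlim
  obtain ⟨n, hn⟩ := (hlim.eventually (gt_mem_nhds (show (0 : ℝ≥0∞) < 1 by simp))).exists
  refine ⟨Metric.closedBall p (1 / ((n : ℝ) + 1)),
    Metric.closedBall_mem_nhds p (by positivity), ?_⟩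
  rcases φ.2.integer _ (Metric.isClosed_closedBall (x := p)
    (ε := 1 / ((n : ℝ) + 1))).measurableSet with h | ⟨k, hk⟩
  · simp only [Function.comp_apply] at hn
    rw [h] at hn
    simp at hn
  · simp only [Function.comp_apply] at hn
    rw [hk] at hn ⊢
    have : k < 1 := by exact_mod_cast hn
    simp [Nat.lt_one_iff.1 this]

/-- The sum over the points of `φ` in `W` is the integral over `W` with respect to `φ`. -/
theorem pointSum_eq_lintegral {d : ℕ} {f : (Fin d → ℝ) × ℝ × Config d → ℝ} (hf : Measurable f)
    {W : Set (Fin d → ℝ)} (hW : MeasurableSet W) (φ : Config d) :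
    pointSum f W φ =
      ∫⁻ p in W ×ˢ (univ : Set ℝ), ENNReal.ofReal (f (p.1, p.2, φ)) ∂φ.1 := by
  classical
  have hWm : MeasurableSet (W ×ˢ (univ : Set ℝ)) := hW.prod MeasurableSet.univ
  have hσ : SigmaFinite φ.1 := by
    obtain ⟨B, hBm, hBb, -, hBu⟩ := exists_partition d
    exact ⟨⟨⟨B, fun _ => trivial, fun k => φ.2.lt_top _ (hBb k), hBu⟩⟩⟩
  set A : Set ((Fin d → ℝ) × ℝ) := {p | φ.1 {p} ≠ 0} with hA
  have hAc : A.Countable := by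
    have := Measure.countable_meas_pos_of_disjoint_iUnion (μ := φ.1)
      (As := fun p : (Fin d → ℝ) × ℝ => {p}) (fun p => measurableSet_singleton p)
      (fun p q h => by simpa using h)
    exact this.mono fun p hp => pos_iff_ne_zero.2 hp
  have hnull : φ.1 Aᶜ = 0 := by
    refine measure_null_of_locally_null _ fun p hp => ?_
    obtain ⟨U, hU, h0⟩ := exists_nhds_null φ p (by simpa [hA] using hp)
    exact ⟨U, mem_nhdsWithin_of_mem_nhds hU, h0⟩
  set g : (Fin d → ℝ) × ℝ → ℝ≥0∞ := fun p => ENNReal.ofReal (f (p.1, p.2, φ)) with hg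
  rw [← lintegral_indicator hWm]
  have hgm : Measurable ((W ×ˢ (univ : Set ℝ)).indicator g) := by
    refine Measurable.indicator ?_ hWm
    exact (hf.comp (by fun_prop)).ennreal_ofReal
  rw [← lintegral_add_compl _ hAc.measurableSet, setLIntegral_measure_zero _ _ hnull, add_zero,
    lintegral_countable _ hAc]
  have h1 : pointSum f W φ =
      ∑' p : (Fin d → ℝ) × ℝ, (W ×ˢ (univ : Set ℝ)).indicator (fun p => g p * φ.1 {p}) p := by
    rw [← tsum_subtype (W ×ˢ (univ : Set ℝ)) (fun p => g p * φ.1 {p})]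
    unfold pointSum
    have hWe : {p : (Fin d → ℝ) × ℝ | p.1 ∈ W} = W ×ˢ (univ : Set ℝ) := by ext p; simp
    rw [← hWe]
    exact tsum_congr fun p => mul_comm _ _
  rw [h1, tsum_subtype A (fun p => (W ×ˢ (univ : Set ℝ)).indicator g p * φ.1 {p})]
  refine tsum_congr fun p => ?_
  by_cases hpA : p ∈ A
  · rw [indicator_of_mem hpA]
    by_cases hpW : p ∈ W ×ˢ (univ : Set ℝ)
    · rw [indicator_of_mem hpW, indicator_of_mem hpW]
    · rw [indicator_of_notMem hpW, indicator_of_notMem hpW, zero_mul]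
  · have h0 : φ.1 {p} = 0 := by simpa [hA] using hpA
    rw [indicator_of_notMem hpA]
    by_cases hpW : p ∈ W ×ˢ (univ : Set ℝ)
    · rw [indicator_of_mem hpW, h0, mul_zero]
    · rw [indicator_of_notMem hpW]

/-- `X_n(φ) = n^{-d} ∑_{(t,y) ∈ φ, t ∈ [0,n]^d} f(t, y, φ)`. -/
noncomputable def spatialAverage {d : ℕ} (f : (Fin d → ℝ) × ℝ × Config d → ℝ)
    (n : ℕ) (φ : Config d) : ℝ≥0∞ :=
  pointSum f (Icc 0 (fun _ => (n : ℝ))) φ / (n : ℝ≥0∞) ^ d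

end MPP

/-!
The random variables `X_n` are, up to boundary terms, averages over cubes of an action of `ℕ^d`:
with `g φ = ∑_{(t,y) ∈ φ, t ∈ [0,1)^d} f(t, y, φ)`, covariance of `f` gives
`∑_{(t,y) ∈ φ, t ∈ [0,n)^d} f(t, y, φ) = ∑_{k ∈ {0,…,n-1}^d} g (T_k φ)`
(`pointSum_halfCube_eq_boxSum`), and closed cubes lie between half-open ones of sides `n` and `n + 1`.

The averages converge almost surely by Wiener's pointwise ergodic theorem (`ae_tendsto_boxSum`),
which rests on two facts. A maximal inequality of weak type (`maximal_inequality`) follows from a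
Vitali covering of the exceptional lattice points. A mean ergodic theorem
(`exists_box_average_near_invariant`) shows that some average of `g` over a cube of side `N` is
within `ε` in `L¹` of an invariant function. Averaging over blocks of side `N` and applying the
maximal inequality to the difference, the averages of `g` oscillate by more than a given amount
only with probability `O(ε)`. Fatou's lemma and the same approximation identify the integral of
the limit (`lintegral_limsup_boxSum`).

Ergodicity is assumed only for the shifts by all of `ℝ^d`, and only for strictly invariant sets,
while the limit is a priori invariant under integer shifts up to null sets. However, the upper
density `limsup n^{-d} ∑_{t ∈ [0,n)^d} f` does not increase under any shift by a vector with
non-negative coordinates (`upperDensity_shift_le`). Its sublevel sets therefore agree in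
probability with strictly invariant sets (`measure_sublevel_eq_zero_or_one`), so that it is almost
surely equal to its mean.
-/

namespace MPP

/-! ### Cubes in `ℕ^d` and the maximal inequality -/

/-- The discrete cube `{0, …, n - 1}^d`. -/
def box (d n : ℕ) : Finset (Fin d → ℕ) := Fintype.piFinset fun _ => Finset.range n

theorem mem_box {d n : ℕ} {k : Fin d → ℕ} : k ∈ box d n ↔ ∀ i, k i < n := by
  simp [box]

theorem card_box (d n : ℕ) : (box d n).card = n ^ d := by
  simp [box]

theorem box_mono (d : ℕ) {m n : ℕ} (h : m ≤ n) : box d m ⊆ box d n := fun _ hk =>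
  mem_box.2 fun i => (mem_box.1 hk i).trans_le h

/-- The covering estimate behind the maximal inequality: if every `a ∈ A` is the corner of a cube of
side `n a` on which `F` averages at least `c`, a disjoint subfamily of these cubes whose threefold
enlargements contain `A` bounds `c * #A` by the total mass of `F`. -/
theorem mul_card_le_of_forall_box {d : ℕ} (F : (Fin d → ℕ) → ℝ≥0∞) (c : ℝ≥0∞) {L M : ℕ}
    (A : Finset (Fin d → ℕ)) (hA : A ⊆ box d L) (n : (Fin d → ℕ) → ℕ)
    (hn1 : ∀ a ∈ A, 1 ≤ n a) (hnM : ∀ a ∈ A, n a ≤ M)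
    (h : ∀ a ∈ A, c * (n a : ℝ≥0∞) ^ d ≤ ∑ k ∈ box d (n a), F (k + a)) :
    c * A.card ≤ 3 ^ d * ∑ k ∈ box d (L + M), F k := by
  classical
  let B : (Fin d → ℕ) → Finset (Fin d → ℕ) := fun a => (box d (n a)).image (· + a)
  obtain ⟨u, huA, hdis, hcov⟩ := Vitali.exists_disjoint_subfamily_covering_enlargement
    (fun a => (B a : Set (Fin d → ℕ))) (A : Set (Fin d → ℕ)) (fun a => (n a : ℝ)) 2 one_lt_two
    (fun a _ => Nat.cast_nonneg _) M (fun a ha => by exact_mod_cast hnM a ha)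
    (fun a ha => ⟨a, by
      simp only [B, Finset.coe_image, Set.mem_image, Finset.mem_coe]
      exact ⟨0, mem_box.2 fun i => hn1 a ha, by simp⟩⟩)
  lift u to Finset (Fin d → ℕ) using A.finite_toSet.subset huA
  have huA' : u ⊆ A := by exact_mod_cast huA
  have hsub : A ⊆ u.biUnion fun b =>
      Fintype.piFinset fun i => Finset.Ico (b i - 2 * n b) (b i + n b) := by
    intro a ha
    obtain ⟨b, hb, ⟨z, hza, hzb⟩, hle⟩ := hcov a ha
    refine Finset.mem_biUnion.2 ⟨b, hb, Fintype.mem_piFinset.2 fun i => ?_⟩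
    simp only [B, Finset.coe_image, Set.mem_image, Finset.mem_coe] at hza hzb
    obtain ⟨k, hk, rfl⟩ := hza
    obtain ⟨l, hl, hkl⟩ := hzb
    have h1 := mem_box.1 hk i
    have h2 := mem_box.1 hl i
    have h3 := congrFun hkl i
    have h4 : n a ≤ 2 * n b := by exact_mod_cast hle
    simp only [Pi.add_apply] at h3
    rw [Finset.mem_Ico]
    omega
  have hcard : A.card ≤ ∑ b ∈ u, (3 * n b) ^ d := by
    refine (Finset.card_le_card hsub).trans (Finset.card_biUnion_le.trans ?_)
    refine Finset.sum_le_sum fun b _ => ?_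
    rw [Fintype.card_piFinset]
    refine (Finset.prod_le_pow_card _ _ (3 * n b) fun i _ => ?_).trans (by simp)
    rw [Nat.card_Ico]
    omega
  calc c * A.card ≤ c * ((∑ b ∈ u, (3 * n b) ^ d : ℕ) : ℝ≥0∞) := by gcongr
    _ = 3 ^ d * ∑ b ∈ u, c * (n b : ℝ≥0∞) ^ d := by
      push_cast
      rw [Finset.mul_sum, Finset.mul_sum]
      refine Finset.sum_congr rfl fun b _ => ?_
      rw [mul_pow]
      ring
    _ ≤ 3 ^ d * ∑ b ∈ u, ∑ k ∈ B b, F k := by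
      gcongr with b hb
      refine (h b (huA' hb)).trans_eq ?_
      rw [Finset.sum_image fun x _ y _ hxy => add_right_cancel hxy]
    _ = 3 ^ d * ∑ k ∈ u.biUnion B, F k := by
      rw [Finset.sum_biUnion]
      intro a ha b hb hab
      exact Finset.disjoint_coe.1 (hdis ha hb hab)
    _ ≤ 3 ^ d * ∑ k ∈ box d (L + M), F k := by
      gcongr
      refine Finset.biUnion_subset.2 fun b hb => Finset.image_subset_iff.2 fun k hk => ?_
      refine mem_box.2 fun i => ?_
      have h1 := mem_box.1 hk i
      have h2 := mem_box.1 (hA (huA' hb)) i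
      have h3 := hnM b (huA' hb)
      simp only [Pi.add_apply]
      omega

theorem tendsto_ratio_pow (d m : ℕ) :
    Tendsto (fun n : ℕ => (((n + m : ℕ) : ℝ≥0∞) / (n : ℝ≥0∞)) ^ d) atTop (𝓝 1) := by
  have h0 : Tendsto (fun n : ℕ => 1 + (m : ℝ≥0∞) / (n : ℝ≥0∞)) atTop (𝓝 (1 + 0)) :=
    tendsto_const_nhds.add (ENNReal.Tendsto.const_div ENNReal.tendsto_nat_nhds_top
      (Or.inr (ENNReal.natCast_ne_top m)) |>.trans (by simp))
  have h1 : Tendsto (fun n : ℕ => ((n + m : ℕ) : ℝ≥0∞) / (n : ℝ≥0∞)) atTop (𝓝 1) := by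
    rw [add_zero] at h0
    refine h0.congr' ?_
    filter_upwards [eventually_ge_atTop 1] with n hn
    have hn0 : (n : ℝ≥0∞) ≠ 0 := by exact_mod_cast (by omega : n ≠ 0)
    rw [Nat.cast_add, ENNReal.add_div, ENNReal.div_self hn0 (ENNReal.natCast_ne_top n)]
  simpa using ENNReal.Tendsto.pow (n := d) h1

/-- Wiener's maximal inequality for actions of `ℕ^d`. -/
theorem maximal_inequality {d : ℕ} {α : Type*} [MeasurableSpace α] {Q : Measure α}
    (S : (Fin d → ℕ) → α → α) (hS : ∀ k, MeasurePreserving (S k) Q Q)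
    (hadd : ∀ a b ω, S (a + b) ω = S a (S b ω)) {G : α → ℝ≥0∞} (hG : Measurable G) (c : ℝ≥0∞) :
    c * Q {ω | ∃ n : ℕ, 1 ≤ n ∧ c * (n : ℝ≥0∞) ^ d ≤ ∑ k ∈ box d n, G (S k ω)} ≤
      3 ^ d * ∫⁻ ω, G ω ∂Q := by
  classical
  have hmeas : ∀ n : ℕ, Measurable fun ω => ∑ k ∈ box d n, G (S k ω) := fun n =>
    Finset.measurable_sum _ fun k _ => hG.comp (hS k).measurable
  let E : ℕ → Set α := fun M =>
    {ω | ∃ n : ℕ, (1 ≤ n ∧ n ≤ M) ∧ c * (n : ℝ≥0∞) ^ d ≤ ∑ k ∈ box d n, G (S k ω)}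
  have hEm : ∀ M, MeasurableSet (E M) := by
    intro M
    have : E M = ⋃ n : ℕ, {ω | (1 ≤ n ∧ n ≤ M) ∧
        c * (n : ℝ≥0∞) ^ d ≤ ∑ k ∈ box d n, G (S k ω)} := by ext; simp [E]
    rw [this]
    refine MeasurableSet.iUnion fun n => ?_
    exact (MeasurableSet.const _).inter (measurableSet_le measurable_const (hmeas n))
  have hfin : ∀ M, c * Q (E M) ≤ 3 ^ d * ∫⁻ ω, G ω ∂Q := by
    intro M
    -- transference: the covering estimate along the orbit of `ω` within a large cube of side `L`
    have hpt : ∀ (L : ℕ) (ω : α), ∑ a ∈ box d L, (E M).indicator (fun _ => c) (S a ω) ≤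
        3 ^ d * ∑ k ∈ box d (L + M), G (S k ω) := by
      intro L ω
      have hex : ∀ a, ∃ n : ℕ, S a ω ∈ E M → (1 ≤ n ∧ n ≤ M) ∧
          c * (n : ℝ≥0∞) ^ d ≤ ∑ k ∈ box d n, G (S k (S a ω)) := by
        intro a
        by_cases ha : S a ω ∈ E M
        · obtain ⟨n, hn⟩ := ha
          exact ⟨n, fun _ => hn⟩
        · exact ⟨0, fun h => absurd h ha⟩
      choose n hn using hex
      have := mul_card_le_of_forall_box (fun k => G (S k ω)) c (L := L) (M := M)
        ((box d L).filter fun a => S a ω ∈ E M) (Finset.filter_subset _ _) n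
        (fun a ha => (hn a (Finset.mem_filter.1 ha).2).1.1)
        (fun a ha => (hn a (Finset.mem_filter.1 ha).2).1.2)
        (fun a ha => by
          simp only [hadd]
          exact (hn a (Finset.mem_filter.1 ha).2).2)
      refine le_trans (le_of_eq ?_) this
      simp only [indicator_apply]
      rw [← Finset.sum_filter, Finset.sum_const, nsmul_eq_mul, mul_comm]
    have hint : ∀ L : ℕ, (L : ℝ≥0∞) ^ d * (c * Q (E M)) ≤
        3 ^ d * (((L + M : ℕ) : ℝ≥0∞) ^ d * ∫⁻ ω, G ω ∂Q) := by
      intro L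
      have h := lintegral_mono (μ := Q) (hpt L)
      have hi : ∀ a, Measurable fun ω => (E M).indicator (fun _ => c) (S a ω) := fun a =>
        (measurable_const.indicator (hEm M)).comp (hS a).measurable
      have hg : ∀ a, Measurable fun ω => G (S a ω) := fun a => hG.comp (hS a).measurable
      rw [lintegral_finsetSum _ fun a _ => hi a, lintegral_const_mul _ (hmeas _),
        lintegral_finsetSum _ fun a _ => hg a] at h
      have h1 : ∀ a, ∫⁻ ω, (E M).indicator (fun _ => c) (S a ω) ∂Q = c * Q (E M) := fun a => by
        rw [(hS a).lintegral_comp (measurable_const.indicator (hEm M)),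
          lintegral_indicator_const (hEm M)]
      have h2 : ∀ a, ∫⁻ ω, G (S a ω) ∂Q = ∫⁻ ω, G ω ∂Q := fun a => (hS a).lintegral_comp hG
      simp only [h1, h2, Finset.sum_const, card_box, nsmul_eq_mul] at h
      exact_mod_cast h
    by_cases hI : ∫⁻ ω, G ω ∂Q = ∞
    · rw [hI, ENNReal.mul_top (by positivity)]
      exact le_top
    have hlim := ENNReal.Tendsto.mul_const (b := 3 ^ d * ∫⁻ ω, G ω ∂Q) (tendsto_ratio_pow d M)
      (Or.inl one_ne_zero)
    rw [one_mul] at hlim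
    refine ge_of_tendsto hlim ?_
    filter_upwards [eventually_ge_atTop 1] with L hL
    have hL0 : (L : ℝ≥0∞) ^ d ≠ 0 := pow_ne_zero _ (by exact_mod_cast (by omega : L ≠ 0))
    have hLt : (L : ℝ≥0∞) ^ d ≠ ∞ := ENNReal.pow_ne_top (ENNReal.natCast_ne_top L)
    rw [div_eq_mul_inv, mul_pow, ← ENNReal.inv_pow, mul_right_comm, ← div_eq_mul_inv,
      ENNReal.le_div_iff_mul_le (Or.inl hL0) (Or.inl hLt), mul_comm]
    refine (hint L).trans_eq ?_
    ring
  have hEU : {ω | ∃ n : ℕ, 1 ≤ n ∧ c * (n : ℝ≥0∞) ^ d ≤ ∑ k ∈ box d n, G (S k ω)} = ⋃ M, E M := by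
    ext ω
    simp only [E, mem_ofPred_eq, mem_iUnion]
    constructor
    · rintro ⟨n, h1, h2⟩
      exact ⟨n, n, ⟨h1, le_rfl⟩, h2⟩
    · rintro ⟨M, n, ⟨h1, -⟩, h2⟩
      exact ⟨n, h1, h2⟩
  have hmono : Monotone E := fun M M' hM ω ⟨n, ⟨h1, h2⟩, h3⟩ => ⟨n, ⟨h1, h2.trans hM⟩, h3⟩
  rw [hEU, hmono.measure_iUnion, ENNReal.mul_iSup]
  exact iSup_le hfin

/-! ### The mean ergodic theorem -/

/-- The averages over large cubes of a coboundary `w - U a w` tend to zero, because the sums over a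
cube and over its translate by `a` cancel up to a boundary layer. -/
theorem tendsto_box_average_coboundary {d : ℕ} {H : Type*} [NormedAddCommGroup H]
    [NormedSpace ℝ H] (U : (Fin d → ℕ) → H →ₗᵢ[ℝ] H)
    (hU : ∀ a b v, U (a + b) v = U a (U b v)) (w : H) (a : Fin d → ℕ) :
    Tendsto (fun N : ℕ => ((N : ℝ) ^ d)⁻¹ • ∑ k ∈ box d N, U k (w - U a w)) atTop (𝓝 0) := by
  classical
  obtain ⟨K, hK⟩ : ∃ K, ∀ i, a i ≤ K := ⟨∑ i, a i, fun i =>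
    Finset.single_le_sum (f := a) (fun _ _ => Nat.zero_le _) (Finset.mem_univ i)⟩
  rw [← tendsto_add_atTop_iff_nat K]
  have hinj : ∀ b : Fin d → ℕ, Function.Injective fun k : Fin d → ℕ => k + b :=
    fun b x y h => add_right_cancel h
  have hbound : ∀ n : ℕ, ‖∑ k ∈ box d (n + K), U k (w - U a w)‖ ≤
      2 * (((n + K : ℕ) : ℝ) ^ d - (n : ℝ) ^ d) * ‖w‖ := by
    intro n
    set s := box d (n + K) with hs
    set s' := s.image (· + a) with hs'
    -- a cube of side `n` contained in both `s` and its translate `s'`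
    set c := (box d n).image (· + fun _ => K) with hc
    have hcs : c ⊆ s := Finset.image_subset_iff.2 fun k hk => mem_box.2 fun i =>
      Nat.add_lt_add_right (mem_box.1 hk i) K
    have hcs' : c ⊆ s' := Finset.image_subset_iff.2 fun k hk => by
      refine Finset.mem_image.2 ⟨fun i => k i + (K - a i), mem_box.2 fun i => ?_, ?_⟩
      · have := mem_box.1 hk i
        omega
      · ext i
        have := hK i
        simp only [Pi.add_apply]
        omega
    have hcc : c.card = n ^ d := by rw [hc, Finset.card_image_of_injective _ (hinj _), card_box]
    have hsc : s.card = (n + K) ^ d := card_box _ _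
    have hsc' : s'.card = (n + K) ^ d := by
      rw [hs', Finset.card_image_of_injective _ (hinj _), hsc]
    have hsum : ∑ k ∈ s, U k (w - U a w) = ∑ k ∈ s \ s', U k w - ∑ k ∈ s' \ s, U k w := by
      rw [Finset.sum_sdiff_sub_sum_sdiff, hs', Finset.sum_image fun x _ y _ h => hinj a h,
        ← Finset.sum_sub_distrib]
      refine Finset.sum_congr rfl fun k _ => ?_
      rw [map_sub, hU]
    have hnorm : ∀ t : Finset (Fin d → ℕ), c ⊆ t → t.card = (n + K) ^ d →
        ∀ t' : Finset (Fin d → ℕ), c ⊆ t' → ‖∑ k ∈ t \ t', U k w‖ ≤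
          (((n + K : ℕ) : ℝ) ^ d - (n : ℝ) ^ d) * ‖w‖ := by
      intro t hct ht t' hct'
      calc ‖∑ k ∈ t \ t', U k w‖ ≤ ∑ k ∈ t \ t', ‖U k w‖ := norm_sum_le _ _
        _ = (t \ t').card * ‖w‖ := by simp
        _ ≤ (t \ c).card * ‖w‖ := by gcongr
        _ = _ := by
          rw [Finset.cast_card_sdiff hct, ht, hcc]
          push_cast
          ring
    rw [hsum]
    refine (norm_sub_le _ _).trans ?_
    have h1 := hnorm s hcs hsc s' hcs'
    have h2 := hnorm s' hcs' hsc' s hcs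
    linarith
  have hlim : Tendsto (fun n : ℕ => 2 * (1 - ((n : ℝ) / ((n : ℝ) + K)) ^ d) * ‖w‖) atTop (𝓝 0) := by
    have := (((tendsto_natCast_div_add_atTop (K : ℝ)).pow d).const_sub 1).const_mul 2
      |>.mul_const ‖w‖
    simpa using this
  refine squeeze_zero_norm' ?_ hlim
  filter_upwards [eventually_ge_atTop 1] with n hn
  have hpos : (0 : ℝ) < (n : ℝ) + K := by
    have : (1 : ℝ) ≤ n := by exact_mod_cast hn
    positivity
  rw [norm_smul, norm_inv, norm_pow, Real.norm_natCast]
  refine (mul_le_mul_of_nonneg_left (hbound n) (by positivity)).trans_eq ?_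
  push_cast
  rw [div_pow]
  field_simp

/-- The mean ergodic theorem for isometric actions of `ℕ^d`, in an approximate form: some average of
`v` over a cube is close to an invariant vector. Invariant vectors and coboundaries together span a
dense subspace, since a vector `x` orthogonal to `x - U k x` satisfies `U k x = x`. -/
theorem exists_box_average_near_invariant {d : ℕ} {H : Type*} [NormedAddCommGroup H]
    [InnerProductSpace ℝ H] [CompleteSpace H] (U : (Fin d → ℕ) → H →ₗᵢ[ℝ] H)
    (hU : ∀ a b v, U (a + b) v = U a (U b v)) (v : H) {ε : ℝ} (hε : 0 < ε) :
    ∃ N : ℕ, 1 ≤ N ∧ ∃ h : H, (∀ k, U k h = h) ∧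
      ‖((N : ℝ) ^ d)⁻¹ • ∑ k ∈ box d N, U k v - h‖ < ε := by
  let F : Submodule ℝ H :=
    { carrier := {v | ∀ k, U k v = v}
      add_mem' := fun {x y} hx hy k => by rw [map_add, hx k, hy k]
      zero_mem' := fun k => map_zero _
      smul_mem' := fun c x hx k => by rw [map_smul, hx k] }
  let C : Submodule ℝ H := Submodule.span ℝ (range fun p : H × (Fin d → ℕ) => p.1 - U p.2 p.1)
  have hC : ∀ c ∈ C, Tendsto (fun N : ℕ => ((N : ℝ) ^ d)⁻¹ • ∑ k ∈ box d N, U k c)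
      atTop (𝓝 0) := by
    intro c hc
    induction hc using Submodule.span_induction with
    | mem x hx =>
      obtain ⟨⟨w, a⟩, rfl⟩ := hx
      exact tendsto_box_average_coboundary U hU w a
    | zero => simp
    | add x y _ _ hx hy =>
      simpa [Finset.sum_add_distrib] using hx.add hy
    | smul r x _ hx =>
      have := hx.const_smul r
      rw [smul_zero] at this
      refine this.congr fun N => ?_
      simp only [map_smul]
      rw [← Finset.smul_sum, smul_comm]
  have hdense : (F ⊔ C).topologicalClosure = ⊤ := by
    rw [Submodule.topologicalClosure_eq_top_iff, Submodule.eq_bot_iff]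
    intro x hx
    have hxF : x ∈ F := by
      intro k
      have h1 : inner ℝ (x - U k x) x = 0 := (Submodule.mem_orthogonal _ _).1 hx _
        (Submodule.mem_sup_right (Submodule.subset_span ⟨(x, k), rfl⟩))
      rw [inner_sub_left, real_inner_self_eq_norm_sq] at h1
      have h2 := norm_sub_sq_real (U k x) x
      rw [(U k).norm_map] at h2
      have h3 : ‖U k x - x‖ ^ 2 = 0 := by linarith
      exact sub_eq_zero.1 (norm_eq_zero.1 (pow_eq_zero_iff two_ne_zero |>.1 h3))
    exact inner_self_eq_zero.1
      ((Submodule.mem_orthogonal _ _).1 hx x (Submodule.mem_sup_left hxF) : inner ℝ x x = 0)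
  obtain ⟨e, he, hve⟩ := Metric.mem_closure_iff.1
    (show v ∈ closure ((F ⊔ C : Submodule ℝ H) : Set H) by
      rw [← Submodule.topologicalClosure_coe, hdense]; trivial) (ε / 2) (half_pos hε)
  obtain ⟨h, hh, c, hc, rfl⟩ := Submodule.mem_sup.1 he
  obtain ⟨N, hN1, hN⟩ := ((eventually_ge_atTop 1).and
    ((hC c hc).eventually (Metric.ball_mem_nhds 0 (half_pos hε)))).exists
  rw [dist_zero_right] at hN
  refine ⟨N, hN1, h, hh, ?_⟩
  have hN0 : (0 : ℝ) < (N : ℝ) ^ d := by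
    have : (0 : ℝ) < N := by exact_mod_cast hN1
    positivity
  have hsplit : ((N : ℝ) ^ d)⁻¹ • ∑ k ∈ box d N, U k v - h =
      ((N : ℝ) ^ d)⁻¹ • ∑ k ∈ box d N, U k (v - (h + c)) +
        ((N : ℝ) ^ d)⁻¹ • ∑ k ∈ box d N, U k c := by
    have hsumh : ((N : ℝ) ^ d)⁻¹ • ∑ k ∈ box d N, U k h = h := by
      rw [Finset.sum_congr rfl fun k _ => hh k, Finset.sum_const, card_box,
        ← Nat.cast_smul_eq_nsmul ℝ, smul_smul]
      push_cast
      rw [inv_mul_cancel₀ hN0.ne', one_smul]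
    simp only [map_sub, map_add, Finset.sum_sub_distrib, Finset.sum_add_distrib, smul_sub, smul_add,
      hsumh]
    abel
  have hcontr : ‖((N : ℝ) ^ d)⁻¹ • ∑ k ∈ box d N, U k (v - (h + c))‖ ≤ ‖v - (h + c)‖ := by
    rw [norm_smul, norm_inv, norm_pow, Real.norm_natCast, inv_mul_le_iff₀ hN0]
    refine (norm_sum_le _ _).trans_eq ?_
    simp only [LinearIsometry.norm_map, Finset.sum_const, card_box, nsmul_eq_mul, Nat.cast_pow]
  rw [dist_eq_norm] at hve
  rw [hsplit]
  refine (norm_add_le _ _).trans_lt ?_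
  linarith

/-- The approximate mean ergodic theorem in `L¹`, from the one in the dense subspace `L²`: averaging
does not increase the `L¹` norm. -/
theorem exists_box_average_near_invariant_L1 {d : ℕ} {α : Type*} [MeasurableSpace α]
    {Q : Measure α} [IsProbabilityMeasure Q]
    (S : (Fin d → ℕ) → α → α) (hS : ∀ k, MeasurePreserving (S k) Q Q)
    (hadd : ∀ a b ω, S (a + b) ω = S a (S b ω)) {g : α → ℝ} (hg : MemLp g 1 Q)
    {ε : ℝ≥0∞} (hε : ε ≠ 0) :
    ∃ N : ℕ, 1 ≤ N ∧ ∃ h : α → ℝ, Measurable h ∧ (∀ k, (fun ω => h (S k ω)) =ᵐ[Q] h) ∧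
      eLpNorm (fun ω => ((N : ℝ) ^ d)⁻¹ * ∑ k ∈ box d N, g (S k ω) - h ω) 1 Q ≤ ε := by
  obtain ⟨g', hgg', -⟩ := hg.exists_simpleFunc_eLpNorm_sub_lt ENNReal.one_ne_top
    (ENNReal.half_pos hε).ne'
  have hg'2 : MemLp g' 2 Q := g'.memLp_of_isFiniteMeasure 2 Q
  let U : (Fin d → ℕ) → Lp ℝ 2 Q →ₗᵢ[ℝ] Lp ℝ 2 Q := fun k =>
    Lp.compMeasurePreservingₗᵢ ℝ (S k) (hS k)
  have hUcoe : ∀ k (v : Lp ℝ 2 Q), (U k v : α → ℝ) =ᵐ[Q] fun ω => v (S k ω) := fun k v =>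
    Lp.coeFn_compMeasurePreserving v (hS k)
  have hU : ∀ a b v, U (a + b) v = U a (U b v) := by
    intro a b v
    refine Lp.ext ?_
    filter_upwards [hUcoe (a + b) v, hUcoe a (U b v),
      (hS a).quasiMeasurePreserving.ae (hUcoe b v)] with ω h1 h2 h3
    rw [h1, h2, h3, add_comm, hadd]
  obtain ⟨N, hN1, h, hinv, hlt⟩ := exists_box_average_near_invariant U hU (hg'2.toLp g')
    (ε := (min (ε / 2) 1).toReal) (ENNReal.toReal_pos
      (lt_min (ENNReal.half_pos hε) one_pos).ne' (by simp))
  have hN0 : ((N : ℝ) ^ d) ≠ 0 := pow_ne_zero _ (by exact_mod_cast (by omega : N ≠ 0))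
  refine ⟨N, hN1, h, (Lp.stronglyMeasurable h).measurable, fun k => ?_, ?_⟩
  · filter_upwards [hUcoe k h] with ω h1
    rw [← h1, hinv k]
  have hfar : eLpNorm (fun ω => ((N : ℝ) ^ d)⁻¹ * ∑ k ∈ box d N, (g - ⇑g') (S k ω)) 1 Q ≤
      ε / 2 := by
    have hm : AEStronglyMeasurable (g - ⇑g') Q :=
      hg.aestronglyMeasurable.sub g'.aestronglyMeasurable
    have h1 : eLpNorm (∑ k ∈ box d N, (g - ⇑g') ∘ S k) 1 Q ≤
        ∑ k ∈ box d N, eLpNorm ((g - ⇑g') ∘ S k) 1 Q :=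
      eLpNorm_sum_le (fun k _ => hm.comp_measurePreserving (hS k)) le_rfl
    simp only [fun k => eLpNorm_comp_measurePreserving (p := 1) hm (hS k), Finset.sum_const,
      card_box, nsmul_eq_mul] at h1
    have h2 : (fun ω => ((N : ℝ) ^ d)⁻¹ * ∑ k ∈ box d N, (g - ⇑g') (S k ω)) =
        ((N : ℝ) ^ d)⁻¹ • ∑ k ∈ box d N, (g - ⇑g') ∘ S k := by
      ext ω
      simp
    rw [h2, eLpNorm_const_smul]
    calc ‖((N : ℝ) ^ d)⁻¹‖ₑ * eLpNorm (∑ k ∈ box d N, (g - ⇑g') ∘ S k) 1 Q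
        ≤ ‖((N : ℝ) ^ d)⁻¹‖ₑ * (((N ^ d : ℕ) : ℝ≥0∞) * (ε / 2)) := by
          gcongr
          exact h1.trans (by gcongr)
      _ = ε / 2 := by
        rw [← mul_assoc, enorm_inv hN0, enorm_pow, Real.enorm_natCast, Nat.cast_pow,
          ENNReal.inv_mul_cancel, one_mul]
        · exact pow_ne_zero _ (by exact_mod_cast (by omega : N ≠ 0))
        · exact ENNReal.pow_ne_top (ENNReal.natCast_ne_top N)
  have hnear : eLpNorm (fun ω => ((N : ℝ) ^ d)⁻¹ * ∑ k ∈ box d N, g' (S k ω) - h ω) 1 Q ≤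
      ε / 2 := by
    have hae : (fun ω => ((N : ℝ) ^ d)⁻¹ * ∑ k ∈ box d N, g' (S k ω) - h ω) =ᵐ[Q]
        ((((N : ℝ) ^ d)⁻¹ • ∑ k ∈ box d N, U k (hg'2.toLp g') - h : Lp ℝ 2 Q) : α → ℝ) := by
      have hk : ∀ᵐ ω ∂Q, ∀ k, U k (hg'2.toLp g') ω = g' (S k ω) := by
        refine ae_all_iff.2 fun k => ?_
        filter_upwards [hUcoe k (hg'2.toLp g'),
          (hS k).quasiMeasurePreserving.ae hg'2.coeFn_toLp] with ω h1 h2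
        rw [h1, h2]
      filter_upwards [hk, Lp.coeFn_sub (((N : ℝ) ^ d)⁻¹ • ∑ k ∈ box d N, U k (hg'2.toLp g')) h,
        Lp.coeFn_smul (((N : ℝ) ^ d)⁻¹) (∑ k ∈ box d N, U k (hg'2.toLp g')),
        Lp.coeFn_fun_finsetSum (box d N) fun k => U k (hg'2.toLp g')] with ω h1 h2 h3 h4
      rw [h2, Pi.sub_apply, h3, Pi.smul_apply, h4, smul_eq_mul]
      simp only [h1]
    rw [eLpNorm_congr_ae hae]
    refine (eLpNorm_le_eLpNorm_of_exponent_le one_le_two (Lp.aestronglyMeasurable _)).trans ?_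
    rw [Lp.norm_def, ENNReal.toReal_lt_toReal (Lp.eLpNorm_ne_top _) (by simp)] at hlt
    exact hlt.le.trans (min_le_left _ _)
  have hsplit : (fun ω => ((N : ℝ) ^ d)⁻¹ * ∑ k ∈ box d N, g (S k ω) - h ω) =
      (fun ω => ((N : ℝ) ^ d)⁻¹ * ∑ k ∈ box d N, (g - ⇑g') (S k ω)) +
        fun ω => ((N : ℝ) ^ d)⁻¹ * ∑ k ∈ box d N, g' (S k ω) - h ω := by
    ext ω
    simp only [Pi.add_apply, Pi.sub_apply, Finset.sum_sub_distrib]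
    ring
  rw [hsplit]
  refine (eLpNorm_add_le ?_ ?_ le_rfl).trans ((add_le_add hfar hnear).trans_eq
    (ENNReal.add_halves ε))
  · refine AEStronglyMeasurable.const_mul ?_ _
    exact Finset.aestronglyMeasurable_fun_sum _ fun k _ =>
      (hg.aestronglyMeasurable.sub g'.aestronglyMeasurable).comp_measurePreserving (hS k)
  · refine AEStronglyMeasurable.sub (AEStronglyMeasurable.const_mul ?_ _)
      (Lp.aestronglyMeasurable h)
    exact Finset.aestronglyMeasurable_fun_sum _ fun k _ =>
      g'.aestronglyMeasurable.comp_measurePreserving (hS k)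

/-! ### The pointwise ergodic theorem -/

theorem sum_box_mul {d : ℕ} {M : Type*} [AddCommMonoid M] (F : (Fin d → ℕ) → M) {N : ℕ}
    (hN : 1 ≤ N) (n : ℕ) :
    ∑ j ∈ box d (N * n), F j = ∑ k ∈ box d n, ∑ r ∈ box d N, F (r + N • k) := by
  rw [← Finset.sum_product' (box d n) (box d N) fun k r => F (r + N • k)]
  refine Finset.sum_bij' (fun j _ => (fun i => j i / N, fun i => j i % N))
    (fun p _ => p.2 + N • p.1) ?_ ?_ ?_ ?_ ?_
  · intro j hj
    rw [Finset.mem_product]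
    exact ⟨mem_box.2 fun i => Nat.div_lt_of_lt_mul (mem_box.1 hj i),
      mem_box.2 fun i => Nat.mod_lt _ hN⟩
  · intro p hp
    rw [Finset.mem_product] at hp
    refine mem_box.2 fun i => ?_
    have h1 := mem_box.1 hp.1 i
    have h2 := mem_box.1 hp.2 i
    simp only [Pi.add_apply, Pi.smul_apply, smul_eq_mul]
    calc p.2 i + N * p.1 i < N * (p.1 i + 1) := by rw [mul_add]; omega
      _ ≤ N * n := Nat.mul_le_mul_left _ h1
  · intro j _
    ext i
    simp only [Pi.add_apply, Pi.smul_apply, smul_eq_mul]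
    exact Nat.mod_add_div _ _
  · intro p hp
    rw [Finset.mem_product] at hp
    ext i
    · simp only [Pi.add_apply, Pi.smul_apply, smul_eq_mul]
      rw [Nat.add_mul_div_left _ _ hN, Nat.div_eq_of_lt (mem_box.1 hp.2 i), zero_add]
    · simp only [Pi.add_apply, Pi.smul_apply, smul_eq_mul]
      rw [Nat.add_mul_mod_self_left, Nat.mod_eq_of_lt (mem_box.1 hp.2 i)]
  · intro j _
    congr 1
    ext i
    simp only [Pi.add_apply, Pi.smul_apply, smul_eq_mul]
    exact (Nat.mod_add_div _ _).symm

/-- The sum of `g` along the part of the orbit of `ω` indexed by the cube `box d n`. -/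
noncomputable def boxSum {d : ℕ} {α : Type*} (S : (Fin d → ℕ) → α → α) (g : α → ℝ≥0∞) (n : ℕ)
    (ω : α) : ℝ≥0∞ :=
  ∑ k ∈ box d n, g (S k ω)

section BoxSum

variable {d : ℕ} {α : Type*} {S : (Fin d → ℕ) → α → α} {g : α → ℝ≥0∞}

theorem monotone_boxSum (S : (Fin d → ℕ) → α → α) (g : α → ℝ≥0∞) (ω : α) :
    Monotone fun n => boxSum S g n ω := fun _ _ h =>
  Finset.sum_le_sum_of_subset (box_mono d h)

/-- A sum over a cube of side `N * n` is a sum over `n ^ d` blocks of side `N`. -/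
theorem boxSum_mul (hadd : ∀ a b ω, S (a + b) ω = S a (S b ω)) {N : ℕ} (hN : 1 ≤ N) (n : ℕ)
    (ω : α) :
    boxSum S g (N * n) ω = boxSum (fun k => S (N • k)) (boxSum S g N) n ω := by
  simp only [boxSum, sum_box_mul _ hN, hadd]

variable [MeasurableSpace α] {Q : Measure α}

theorem measurable_boxSum (hS : ∀ k, Measurable (S k)) (hg : Measurable g) (n : ℕ) :
    Measurable (boxSum S g n) :=
  Finset.measurable_fun_sum _ fun k _ => hg.comp (hS k)

theorem lintegral_boxSum (hS : ∀ k, MeasurePreserving (S k) Q Q) (hg : Measurable g) (n : ℕ) :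
    ∫⁻ ω, boxSum S g n ω ∂Q = (n : ℝ≥0∞) ^ d * ∫⁻ ω, g ω ∂Q := by
  unfold boxSum
  have hm : ∀ k, Measurable fun ω => g (S k ω) := fun k => hg.comp (hS k).measurable
  rw [lintegral_finsetSum _ fun k _ => hm k,
    Finset.sum_congr rfl fun k _ => (hS k).lintegral_comp hg, Finset.sum_const, card_box,
    nsmul_eq_mul, Nat.cast_pow]

end BoxSum

theorem natCast_pow_ne_zero {n : ℕ} (hn : 1 ≤ n) (d : ℕ) : (n : ℝ≥0∞) ^ d ≠ 0 :=
  pow_ne_zero _ (by exact_mod_cast (by omega : n ≠ 0))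

theorem natCast_pow_ne_top (n d : ℕ) : (n : ℝ≥0∞) ^ d ≠ ∞ :=
  ENNReal.pow_ne_top (ENNReal.natCast_ne_top n)

/-- For a monotone sequence it suffices to bound its volume averages along the multiples of `N`. -/
theorem limsup_div_pow_le_of_mul {d N : ℕ} (hN : 1 ≤ N) {M : ℕ → ℝ≥0∞} (hM : Monotone M)
    {a : ℝ≥0∞} (h : ∀ n, 1 ≤ n → M (N * n) ≤ a * ((N * n : ℕ) : ℝ≥0∞) ^ d) :
    limsup (fun n : ℕ => M n / (n : ℝ≥0∞) ^ d) atTop ≤ a := by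
  have hlim := ENNReal.Tendsto.const_mul (a := a) (tendsto_ratio_pow d N) (Or.inl one_ne_zero)
  rw [mul_one] at hlim
  rw [← hlim.limsup_eq]
  refine limsup_le_limsup ?_
  filter_upwards with n
  have h1 : n ≤ N * (n / N + 1) := (Nat.lt_mul_div_succ n hN).le
  have h2 : N * (n / N + 1) ≤ n + N := by
    have := Nat.mul_div_le n N
    rw [mul_add]
    omega
  rw [div_eq_mul_inv _ (n : ℝ≥0∞), mul_pow, ← ENNReal.inv_pow, ← mul_assoc, div_eq_mul_inv]
  gcongr
  refine (hM h1).trans ((h _ (Nat.le_add_left 1 _)).trans ?_)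
  gcongr

theorem le_liminf_div_pow_of_mul {d N : ℕ} (hN : 1 ≤ N) {M : ℕ → ℝ≥0∞} (hM : Monotone M)
    {b : ℝ≥0∞} (h : ∀ n, 1 ≤ n → b * ((N * n : ℕ) : ℝ≥0∞) ^ d ≤ M (N * n)) :
    b ≤ liminf (fun n : ℕ => M n / (n : ℝ≥0∞) ^ d) atTop := by
  have hlim := ENNReal.Tendsto.const_mul (a := b) (tendsto_inv_iff.2 (tendsto_ratio_pow d N))
    (Or.inl (by simp))
  rw [inv_one, mul_one] at hlim
  rw [← hlim.liminf_eq, ← liminf_nat_add (fun n : ℕ => M n / (n : ℝ≥0∞) ^ d) N]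
  refine liminf_le_liminf ?_
  filter_upwards [eventually_ge_atTop 1] with n hn
  have h0 : 1 ≤ (n + N) / N := (Nat.one_le_div_iff hN).2 (by omega)
  have h1 : n ≤ N * ((n + N) / N) := by
    rw [Nat.add_div_right _ hN]
    exact (Nat.lt_mul_div_succ n hN).le
  have h2 : N * ((n + N) / N) ≤ n + N := Nat.mul_div_le _ _
  rw [ENNReal.inv_pow, ENNReal.inv_div (Or.inl (ENNReal.natCast_ne_top n))
    (Or.inl (by exact_mod_cast (by omega : n ≠ 0))), div_eq_mul_inv _ ((n + N : ℕ) : ℝ≥0∞), mul_pow,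
    ← ENNReal.inv_pow, ← mul_assoc, div_eq_mul_inv]
  gcongr
  refine le_trans ?_ ((h _ h0).trans (hM h2))
  gcongr

section Wiener

variable {d : ℕ} {α : Type*} [MeasurableSpace α] {Q : Measure α} [IsProbabilityMeasure Q]
  {S : (Fin d → ℕ) → α → α} {g : α → ℝ≥0∞}

/-- The approximate mean ergodic theorem in `L¹`, for extended non-negative functions: up to an
error `D` of small integral, an average of `g` over a cube is an invariant function `H`. -/
theorem exists_near_invariant (hS : ∀ k, MeasurePreserving (S k) Q Q)
    (hadd : ∀ a b ω, S (a + b) ω = S a (S b ω)) (hg : Measurable g) (hgI : ∫⁻ ω, g ω ∂Q ≠ ∞)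
    {ε : ℝ≥0∞} (hε : ε ≠ 0) :
    ∃ N : ℕ, 1 ≤ N ∧ ∃ H D : α → ℝ≥0∞, Measurable H ∧ Measurable D ∧ ∫⁻ ω, D ω ∂Q ≤ ε ∧
      (∀ᵐ ω ∂Q, ∀ k, H (S k ω) = H ω) ∧
      (∀ᵐ ω ∂Q, boxSum S g N ω ≤ (N : ℝ≥0∞) ^ d * (H ω + D ω)) ∧
      ∀ᵐ ω ∂Q, (N : ℝ≥0∞) ^ d * H ω ≤ boxSum S g N ω + (N : ℝ≥0∞) ^ d * D ω := by
  have hgr : MemLp (fun ω => (g ω).toReal) 1 Q :=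
    memLp_one_iff_integrable.2 (integrable_toReal_of_lintegral_ne_top hg.aemeasurable hgI)
  obtain ⟨N, hN, h, hm, hinv, hle⟩ := exists_box_average_near_invariant_L1 S hS hadd hgr hε
  set A : α → ℝ := fun ω => ((N : ℝ) ^ d)⁻¹ * ∑ k ∈ box d N, (g (S k ω)).toReal with hA
  have hAm : Measurable A := (Finset.measurable_fun_sum _ fun k _ =>
    (hg.comp (hS k).measurable).ennreal_toReal).const_mul _
  have hfin : ∀ᵐ ω ∂Q, ∀ k, g (S k ω) < ∞ := ae_all_iff.2 fun k =>
    (hS k).quasiMeasurePreserving.ae (ae_lt_top hg hgI)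
  have hAeq : ∀ᵐ ω ∂Q, boxSum S g N ω = (N : ℝ≥0∞) ^ d * ENNReal.ofReal (A ω) := by
    filter_upwards [hfin] with ω hω
    rw [hA, ENNReal.ofReal_mul (by positivity), ENNReal.ofReal_inv_of_pos (by
        have : (0 : ℝ) < N := by exact_mod_cast hN
        positivity),
      ENNReal.ofReal_pow (Nat.cast_nonneg _), ENNReal.ofReal_natCast, ← mul_assoc,
      ENNReal.mul_inv_cancel (natCast_pow_ne_zero hN d) (natCast_pow_ne_top N d), one_mul,
      ENNReal.ofReal_sum_of_nonneg fun _ _ => ENNReal.toReal_nonneg]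
    exact Finset.sum_congr rfl fun k _ => (ENNReal.ofReal_toReal (hω k).ne).symm
  -- `A ≥ 0`, so passing to the positive part of `h` keeps both one-sided bounds
  refine ⟨N, hN, fun ω => ENNReal.ofReal (h ω), fun ω => ‖A ω - h ω‖ₑ, hm.ennreal_ofReal,
    (hAm.sub hm).enorm, ?_, ?_, ?_, ?_⟩
  · rwa [eLpNorm_one_eq_lintegral_enorm] at hle
  · filter_upwards [ae_all_iff.2 hinv] with ω hω k
    rw [hω k]
  · filter_upwards [hAeq] with ω hω
    rw [hω]
    gcongr
    rw [Real.enorm_eq_ofReal_abs]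
    refine le_trans (ENNReal.ofReal_le_ofReal ?_) ENNReal.ofReal_add_le
    linarith [le_abs_self (A ω - h ω)]
  · filter_upwards [hAeq] with ω hω
    rw [hω, ← mul_add]
    gcongr
    rw [Real.enorm_eq_ofReal_abs]
    refine le_trans (ENNReal.ofReal_le_ofReal ?_) ENNReal.ofReal_add_le
    linarith [neg_abs_le (A ω - h ω)]

/-- The approximate identities of `exists_near_invariant`, summed over blocks of side `N`. -/
theorem exists_near_invariant_blocks (hS : ∀ k, MeasurePreserving (S k) Q Q)
    (hadd : ∀ a b ω, S (a + b) ω = S a (S b ω)) (hg : Measurable g) (hgI : ∫⁻ ω, g ω ∂Q ≠ ∞)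
    {ε : ℝ≥0∞} (hε : ε ≠ 0) :
    ∃ N : ℕ, 1 ≤ N ∧ ∃ H D : α → ℝ≥0∞, Measurable H ∧ Measurable D ∧ ∫⁻ ω, D ω ∂Q ≤ ε ∧
      ∀ᵐ ω ∂Q, ∀ n,
        boxSum S g (N * n) ω ≤
          (N : ℝ≥0∞) ^ d * ((n : ℝ≥0∞) ^ d * H ω + boxSum (fun k => S (N • k)) D n ω) ∧
        (N : ℝ≥0∞) ^ d * ((n : ℝ≥0∞) ^ d * H ω) ≤
          boxSum S g (N * n) ω + (N : ℝ≥0∞) ^ d * boxSum (fun k => S (N • k)) D n ω := by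
  obtain ⟨N, hN, H, D, hH, hD, hDε, hinv, hup, hlow⟩ := exists_near_invariant hS hadd hg hgI hε
  refine ⟨N, hN, H, D, hH, hD, hDε, ?_⟩
  filter_upwards [hinv, ae_all_iff.2 fun k => (hS k).quasiMeasurePreserving.ae hup,
    ae_all_iff.2 fun k => (hS k).quasiMeasurePreserving.ae hlow] with ω h1 h2 h3 n
  have hsum : (n : ℝ≥0∞) ^ d * H ω = ∑ k ∈ box d n, H (S (N • k) ω) := by
    simp [h1, card_box]
  rw [boxSum_mul hadd hN, hsum]
  simp only [boxSum]
  constructor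
  · rw [← Finset.sum_add_distrib, Finset.mul_sum]
    exact Finset.sum_le_sum fun k _ => h2 (N • k)
  · rw [Finset.mul_sum, Finset.mul_sum, ← Finset.sum_add_distrib]
    exact Finset.sum_le_sum fun k _ => h3 (N • k)

/-- The averages over cubes converge almost everywhere: by the maximal inequality, applied to the
block error `D`, they oscillate by more than `2 * c` only on a set of arbitrarily small measure. -/
theorem ae_limsup_le_liminf (hS : ∀ k, MeasurePreserving (S k) Q Q)
    (hadd : ∀ a b ω, S (a + b) ω = S a (S b ω)) (hg : Measurable g) (hgI : ∫⁻ ω, g ω ∂Q ≠ ∞) :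
    ∀ᵐ ω ∂Q, limsup (fun n : ℕ => boxSum S g n ω / (n : ℝ≥0∞) ^ d) atTop ≤
      liminf (fun n : ℕ => boxSum S g n ω / (n : ℝ≥0∞) ^ d) atTop := by
  have key : ∀ c : ℝ≥0∞, c ≠ 0 → c ≠ ∞ → ∀ᵐ ω ∂Q,
      limsup (fun n : ℕ => boxSum S g n ω / (n : ℝ≥0∞) ^ d) atTop ≤
        liminf (fun n : ℕ => boxSum S g n ω / (n : ℝ≥0∞) ^ d) atTop + c + c := by
    intro c hc hc'
    rw [ae_iff]
    have hle : ∀ ε : ℝ≥0∞, ε ≠ 0 → c * Q {ω | ¬ limsup (fun n : ℕ => boxSum S g n ω /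
        (n : ℝ≥0∞) ^ d) atTop ≤ liminf (fun n : ℕ => boxSum S g n ω / (n : ℝ≥0∞) ^ d) atTop +
          c + c} ≤ 3 ^ d * ε := by
      intro ε hε
      obtain ⟨N, hN, H, D, hH, hD, hDε, hblock⟩ := exists_near_invariant_blocks hS hadd hg hgI hε
      have hmax := maximal_inequality (fun k => S (N • k)) (fun k => hS _)
        (fun a b ω => by rw [smul_add, hadd]) hD c
      refine le_trans ?_ (hmax.trans (by gcongr))
      gcongr 1
      refine measure_mono_ae ?_
      filter_upwards [hblock] with ω hω hbad
      by_contra hgood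
      refine hbad ?_
      have hlt : ∀ n, 1 ≤ n → boxSum (fun k => S (N • k)) D n ω ≤ c * (n : ℝ≥0∞) ^ d := by
        intro n hn
        by_contra hcon
        exact hgood ⟨n, hn, (not_le.1 hcon).le⟩
      have hup : limsup (fun n : ℕ => boxSum S g n ω / (n : ℝ≥0∞) ^ d) atTop ≤ H ω + c := by
        refine limsup_div_pow_le_of_mul hN (monotone_boxSum S g ω) fun n hn => ?_
        refine (hω n).1.trans ?_
        calc (N : ℝ≥0∞) ^ d * ((n : ℝ≥0∞) ^ d * H ω + boxSum (fun k => S (N • k)) D n ω)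
            ≤ (N : ℝ≥0∞) ^ d * ((n : ℝ≥0∞) ^ d * H ω + c * (n : ℝ≥0∞) ^ d) := by
              gcongr; exact hlt n hn
          _ = _ := by push_cast; rw [mul_pow]; ring
      have hlow : H ω - c ≤ liminf (fun n : ℕ => boxSum S g n ω / (n : ℝ≥0∞) ^ d) atTop := by
        refine le_liminf_div_pow_of_mul hN (monotone_boxSum S g ω) fun n hn => ?_
        rw [ENNReal.sub_mul fun _ _ => natCast_pow_ne_top _ _, tsub_le_iff_right]
        calc H ω * ((N * n : ℕ) : ℝ≥0∞) ^ d = (N : ℝ≥0∞) ^ d * ((n : ℝ≥0∞) ^ d * H ω) := by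
              push_cast; rw [mul_pow]; ring
          _ ≤ _ := (hω n).2
          _ ≤ boxSum S g (N * n) ω + (N : ℝ≥0∞) ^ d * (c * (n : ℝ≥0∞) ^ d) := by
              gcongr; exact hlt n hn
          _ = _ := by push_cast; rw [mul_pow]; ring
      refine hup.trans ?_
      gcongr
      exact tsub_le_iff_right.1 hlow
    have hzero : c * Q {ω | ¬ limsup (fun n : ℕ => boxSum S g n ω /
        (n : ℝ≥0∞) ^ d) atTop ≤ liminf (fun n : ℕ => boxSum S g n ω / (n : ℝ≥0∞) ^ d) atTop +
          c + c} = 0 := by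
      refine le_antisymm (ENNReal.le_of_forall_pos_le_add fun η hη _ => ?_) zero_le
      have h3 : (3 : ℝ≥0∞) ^ d ≠ 0 := by positivity
      have h3' : (3 : ℝ≥0∞) ^ d ≠ ∞ := ENNReal.pow_ne_top (by simp)
      refine (hle (η / 3 ^ d) (ENNReal.div_pos (by exact_mod_cast hη.ne') h3').ne').trans_eq ?_
      rw [ENNReal.mul_div_cancel h3 h3', zero_add]
    exact (mul_eq_zero.1 hzero).resolve_left hc
  have hall : ∀ᵐ ω ∂Q, ∀ m : ℕ, limsup (fun n : ℕ => boxSum S g n ω / (n : ℝ≥0∞) ^ d) atTop ≤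
      liminf (fun n : ℕ => boxSum S g n ω / (n : ℝ≥0∞) ^ d) atTop + ((m : ℝ≥0∞) + 1)⁻¹ +
        ((m : ℝ≥0∞) + 1)⁻¹ :=
    ae_all_iff.2 fun m => key _ (by simp) (by simp)
  filter_upwards [hall] with ω hω
  have hlim : Tendsto (fun m : ℕ => ((m : ℝ≥0∞) + 1)⁻¹) atTop (𝓝 0) := by
    have := (tendsto_add_atTop_iff_nat 1).2 ENNReal.tendsto_inv_nat_nhds_zero
    exact_mod_cast this
  have h2 := (hlim.const_add
    (liminf (fun n : ℕ => boxSum S g n ω / (n : ℝ≥0∞) ^ d) atTop)).add hlim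
  rw [add_zero, add_zero] at h2
  exact ge_of_tendsto' h2 hω

/-- Wiener's pointwise ergodic theorem for measure preserving actions of `ℕ^d`. -/
theorem ae_tendsto_boxSum (hS : ∀ k, MeasurePreserving (S k) Q Q)
    (hadd : ∀ a b ω, S (a + b) ω = S a (S b ω)) (hg : Measurable g) (hgI : ∫⁻ ω, g ω ∂Q ≠ ∞) :
    ∀ᵐ ω ∂Q, Tendsto (fun n : ℕ => boxSum S g n ω / (n : ℝ≥0∞) ^ d) atTop
      (𝓝 (limsup (fun n : ℕ => boxSum S g n ω / (n : ℝ≥0∞) ^ d) atTop)) := by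
  filter_upwards [ae_limsup_le_liminf hS hadd hg hgI] with ω hω
  exact tendsto_of_le_liminf_of_limsup_le hω le_rfl

/-- The limit in the pointwise ergodic theorem has the same integral as `g`. One inequality is
Fatou's lemma; for the other, `H` from `exists_near_invariant_blocks` nearly has the integral of `g`
and is at most the limit up to an error of small mean. -/
theorem lintegral_limsup_boxSum (hS : ∀ k, MeasurePreserving (S k) Q Q)
    (hadd : ∀ a b ω, S (a + b) ω = S a (S b ω)) (hg : Measurable g) (hgI : ∫⁻ ω, g ω ∂Q ≠ ∞) :
    ∫⁻ ω, limsup (fun n : ℕ => boxSum S g n ω / (n : ℝ≥0∞) ^ d) atTop ∂Q = ∫⁻ ω, g ω ∂Q := by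
  have hmeas : ∀ n, Measurable fun ω => boxSum S g n ω / (n : ℝ≥0∞) ^ d := fun n =>
    (measurable_boxSum (fun k => (hS k).measurable) hg n).div_const _
  have hmean : ∀ (T : (Fin d → ℕ) → α → α), (∀ k, MeasurePreserving (T k) Q Q) →
      ∀ u : α → ℝ≥0∞, Measurable u → ∀ n : ℕ, 1 ≤ n →
      ∫⁻ ω, boxSum T u n ω / (n : ℝ≥0∞) ^ d ∂Q = ∫⁻ ω, u ω ∂Q := by
    intro T hT u hu n hn
    simp only [div_eq_mul_inv]
    rw [lintegral_mul_const _ (measurable_boxSum (fun k => (hT k).measurable) hu n),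
      lintegral_boxSum hT hu, ← div_eq_mul_inv, mul_comm,
      ENNReal.mul_div_cancel_right (natCast_pow_ne_zero hn d) (natCast_pow_ne_top n d)]
  have hlim := ae_tendsto_boxSum hS hadd hg hgI
  have hfatou : ∀ (T : (Fin d → ℕ) → α → α), (∀ k, MeasurePreserving (T k) Q Q) →
      ∀ u : α → ℝ≥0∞, Measurable u →
      ∫⁻ ω, liminf (fun n : ℕ => boxSum T u n ω / (n : ℝ≥0∞) ^ d) atTop ∂Q ≤ ∫⁻ ω, u ω ∂Q := by
    intro T hT u hu
    refine (lintegral_liminf_le fun n =>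
      (measurable_boxSum (fun k => (hT k).measurable) hu n).div_const _).trans_eq ?_
    refine Tendsto.liminf_eq (tendsto_const_nhds.congr' ?_)
    filter_upwards [eventually_ge_atTop 1] with n hn
    exact (hmean T hT u hu n hn).symm
  refine le_antisymm ?_ ?_
  · refine le_trans (le_of_eq (lintegral_congr_ae ?_)) (hfatou S hS g hg)
    filter_upwards [hlim] with ω hω
    exact hω.liminf_eq.symm
  · refine ENNReal.le_of_forall_pos_le_add fun η hη _ => ?_
    have hη' : (η : ℝ≥0∞) ≠ 0 := by exact_mod_cast hη.ne'
    obtain ⟨N, hN, H, D, hH, hD, hDε, hblock⟩ :=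
      exists_near_invariant_blocks hS hadd hg hgI (ENNReal.half_pos hη').ne'
    have hTS : ∀ k : Fin d → ℕ, MeasurePreserving (S (N • k)) Q Q := fun k => hS _
    -- the block identities bound `H` by the limit plus the averaged error, whose mean is small
    have hHle : ∀ᵐ ω ∂Q, H ω ≤ limsup (fun n : ℕ => boxSum S g n ω / (n : ℝ≥0∞) ^ d) atTop +
        liminf (fun n : ℕ => boxSum (fun k => S (N • k)) D n ω / (n : ℝ≥0∞) ^ d) atTop := by
      filter_upwards [hblock, hlim] with ω h1 h2
      have hsub : Tendsto (fun n : ℕ => N * n) atTop atTop :=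
        tendsto_id.const_mul_atTop' hN
      rw [← (h2.comp hsub).limsup_eq]
      refine ENNReal.le_of_forall_pos_le_add fun δ hδ hfin => ?_
      set ℓ := limsup ((fun n : ℕ => boxSum S g n ω / (n : ℝ≥0∞) ^ d) ∘ fun n => N * n) atTop
      have hℓ : ℓ < ℓ + δ := ENNReal.lt_add_right (ne_top_of_le_ne_top hfin.ne le_self_add)
        (by exact_mod_cast hδ.ne')
      rw [add_right_comm, add_comm (ℓ + (δ : ℝ≥0∞)), ← tsub_le_iff_right]
      refine le_liminf_of_le (by isBoundedDefault) ?_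
      filter_upwards [eventually_ge_atTop 1, eventually_lt_of_limsup_lt hℓ] with n hn hlt
      have hn0 := natCast_pow_ne_zero hn d
      have hn1 := natCast_pow_ne_top n d
      have hN0 := natCast_pow_ne_zero hN d
      have hN1 := natCast_pow_ne_top N d
      rw [tsub_le_iff_left]
      have hle : boxSum S g (N * n) ω ≤ (ℓ + δ) * ((N : ℝ≥0∞) ^ d * (n : ℝ≥0∞) ^ d) := by
        rw [← mul_pow, ← Nat.cast_mul]
        exact (ENNReal.div_le_iff (natCast_pow_ne_zero (Nat.mul_pos hN hn) d)
          (natCast_pow_ne_top _ d)).1 hlt.le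
      rw [← ENNReal.mul_le_mul_iff_right (mul_ne_zero hN0 hn0) (ENNReal.mul_ne_top hN1 hn1),
        mul_assoc]
      refine ((h1 n).2.trans (add_le_add_left hle _)).trans_eq ?_
      rw [mul_add, mul_comm (ℓ + (δ : ℝ≥0∞)), mul_assoc _ _ (_ / _),
        ENNReal.mul_div_cancel hn0 hn1]
    have hHD : ∀ᵐ ω ∂Q, boxSum S g N ω / (N : ℝ≥0∞) ^ d ≤
        H ω + boxSum (fun k => S (N • k)) D 1 ω := by
      filter_upwards [hblock] with ω h1
      have := (h1 1).1
      rw [mul_one, Nat.cast_one, one_pow, one_mul, mul_comm] at this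
      exact ENNReal.div_le_of_le_mul this
    calc ∫⁻ ω, g ω ∂Q = ∫⁻ ω, boxSum S g N ω / (N : ℝ≥0∞) ^ d ∂Q := (hmean S hS g hg N hN).symm
      _ ≤ ∫⁻ ω, (H ω + boxSum (fun k => S (N • k)) D 1 ω) ∂Q := lintegral_mono_ae hHD
      _ = ∫⁻ ω, H ω ∂Q + ∫⁻ ω, D ω ∂Q := by
        rw [lintegral_add_left hH, lintegral_boxSum hTS hD, Nat.cast_one, one_pow, one_mul]
      _ ≤ (∫⁻ ω, limsup (fun n : ℕ => boxSum S g n ω / (n : ℝ≥0∞) ^ d) atTop ∂Q + η / 2) +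
          η / 2 := by
        gcongr
        refine (lintegral_mono_ae hHle).trans ?_
        rw [lintegral_add_left (Measurable.limsup hmeas)]
        gcongr
        exact (hfatou _ hTS D hD).trans hDε
      _ = _ := by rw [add_assoc, ENNReal.add_halves]

end Wiener

/-! ### Sums over the points of a configuration -/

section PointSum

variable {d : ℕ} {f : (Fin d → ℝ) × ℝ × Config d → ℝ}

theorem shift_add (a b : Fin d → ℝ) (φ : Config d) : shift (a + b) φ = shift a (shift b φ) := by
  refine Subtype.ext ?_
  change φ.1.map _ = (φ.1.map _).map _
  rw [Measure.map_map (measurable_translate a) (measurable_translate b)]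
  congr 1
  ext p
  · simp only [Function.comp_apply, Pi.sub_apply, Pi.add_apply]
    ring
  · rfl

theorem measurable_pointSum (hf : Measurable f) {W : Set (Fin d → ℝ)} (hW : MeasurableSet W) :
    Measurable (pointSum f W) := by
  have h : pointSum f W = fun φ =>
      ∫⁻ p in W ×ˢ (univ : Set ℝ), ENNReal.ofReal (f (p.1, p.2, φ)) ∂(pointKernel d φ) := by
    ext φ
    exact pointSum_eq_lintegral hf hW φ
  rw [h]
  have hF : Measurable fun q : Config d × ((Fin d → ℝ) × ℝ) =>
      ENNReal.ofReal (f (q.2.1, q.2.2, q.1)) := (hf.comp (by fun_prop)).ennreal_ofReal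
  exact hF.setLIntegral_kernel_prod_right (hW.prod MeasurableSet.univ)

theorem pointSum_mono (hf : Measurable f) {V W : Set (Fin d → ℝ)} (hV : MeasurableSet V)
    (hW : MeasurableSet W) (h : V ⊆ W) (φ : Config d) : pointSum f V φ ≤ pointSum f W φ := by
  rw [pointSum_eq_lintegral hf hV, pointSum_eq_lintegral hf hW]
  exact lintegral_mono_set (prod_mono_left h)

/-- For covariant `f`, shifting the configuration amounts to translating the window. -/
theorem pointSum_shift (hf : Measurable f)
    (hcov : ∀ (t x : Fin d → ℝ) (y : ℝ) (φ : Config d), f (t - x, y, shift x φ) = f (t, y, φ))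
    {W : Set (Fin d → ℝ)} (hW : MeasurableSet W) (x : Fin d → ℝ) (φ : Config d) :
    pointSum f W (shift x φ) = pointSum f ((fun t => t - x) ⁻¹' W) φ := by
  rw [pointSum_eq_lintegral hf hW, pointSum_eq_lintegral hf ((measurable_sub_const x) hW)]
  change ∫⁻ p in W ×ˢ (univ : Set ℝ), ENNReal.ofReal (f (p.1, p.2, shift x φ))
    ∂(φ.1.map fun p => (p.1 - x, p.2)) = _
  have hF : Measurable fun p : (Fin d → ℝ) × ℝ => ENNReal.ofReal (f (p.1, p.2, shift x φ)) :=
    (hf.comp (by fun_prop)).ennreal_ofReal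
  rw [setLIntegral_map (hW.prod MeasurableSet.univ) hF (measurable_translate x)]
  simp only [hcov]
  congr 2

/-- The half-open cube `[0, s)^d`. -/
def halfCube (d : ℕ) (s : ℝ) : Set (Fin d → ℝ) := Set.pi univ fun _ => Ico 0 s

theorem mem_halfCube {s : ℝ} {t : Fin d → ℝ} : t ∈ halfCube d s ↔ ∀ i, 0 ≤ t i ∧ t i < s := by
  simp [halfCube]

theorem measurableSet_halfCube (d : ℕ) (s : ℝ) : MeasurableSet (halfCube d s) :=
  MeasurableSet.univ_pi fun _ => measurableSet_Ico

/-- A half-open cube of side `m * s` is tiled by `m ^ d` translates of the one of side `s`. -/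
theorem pointSum_halfCube_mul (hf : Measurable f)
    (hcov : ∀ (t x : Fin d → ℝ) (y : ℝ) (φ : Config d), f (t - x, y, shift x φ) = f (t, y, φ))
    {s : ℝ} (hs : 0 < s) (m : ℕ) (φ : Config d) :
    pointSum f (halfCube d (m * s)) φ =
      ∑ k ∈ box d m, pointSum f (halfCube d s) (shift (fun i => (k i : ℝ) * s) φ) := by
  have hWm : ∀ k : Fin d → ℕ,
      MeasurableSet ((fun t : Fin d → ℝ => t - fun i => (k i : ℝ) * s) ⁻¹' halfCube d s) :=
    fun k => measurable_sub_const _ (measurableSet_halfCube d s)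
  have hmem : ∀ (k : Fin d → ℕ) (t : Fin d → ℝ),
      t ∈ (fun t : Fin d → ℝ => t - fun i => (k i : ℝ) * s) ⁻¹' halfCube d s ↔
        ∀ i, 0 ≤ t i ∧ ⌊t i / s⌋₊ = k i := by
    intro k t
    rw [mem_preimage, mem_halfCube]
    refine forall_congr' fun i => ?_
    simp only [Pi.sub_apply]
    constructor
    · rintro ⟨h1, h2⟩
      have h0 : 0 ≤ t i := le_trans (by positivity) (sub_nonneg.1 h1)
      refine ⟨h0, (Nat.floor_eq_iff (div_nonneg h0 hs.le)).2 ⟨?_, ?_⟩⟩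
      · rw [le_div_iff₀ hs]
        linarith
      · rw [div_lt_iff₀ hs]
        linarith
    · rintro ⟨h0, h⟩
      obtain ⟨h1, h2⟩ := (Nat.floor_eq_iff (div_nonneg h0 hs.le)).1 h
      rw [le_div_iff₀ hs] at h1
      rw [div_lt_iff₀ hs] at h2
      constructor <;> linarith
  have hU : halfCube d (m * s) ×ˢ (univ : Set ℝ) = ⋃ k ∈ box d m,
      ((fun t : Fin d → ℝ => t - fun i => (k i : ℝ) * s) ⁻¹' halfCube d s) ×ˢ (univ : Set ℝ) := by
    ext ⟨t, y⟩
    simp only [mem_prod, mem_univ, and_true, mem_iUnion, exists_prop, hmem, mem_halfCube, mem_box]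
    constructor
    · intro h
      refine ⟨fun i => ⌊t i / s⌋₊, fun i => ?_, fun i => ⟨(h i).1, rfl⟩⟩
      rw [Nat.floor_lt (div_nonneg (h i).1 hs.le), div_lt_iff₀ hs]
      exact (h i).2
    · rintro ⟨k, hk, h⟩ i
      refine ⟨(h i).1, ?_⟩
      rw [← div_lt_iff₀ hs, ← Nat.floor_lt (div_nonneg (h i).1 hs.le), (h i).2]
      exact hk i
  rw [pointSum_eq_lintegral hf (measurableSet_halfCube d _), hU, lintegral_biUnion_finset]
  · refine Finset.sum_congr rfl fun k _ => ?_
    rw [pointSum_shift hf hcov (measurableSet_halfCube d s), pointSum_eq_lintegral hf (hWm k)]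
  · intro k _ l _ hkl
    refine Set.disjoint_left.2 ?_
    rintro ⟨t, y⟩ h1 h2
    refine hkl (funext fun i => ?_)
    rw [← (((hmem k t).1 h1.1) i).2, ← (((hmem l t).1 h2.1) i).2]
  · exact fun k _ => (hWm k).prod MeasurableSet.univ

theorem pointSum_halfCube_eq_boxSum (hf : Measurable f)
    (hcov : ∀ (t x : Fin d → ℝ) (y : ℝ) (φ : Config d), f (t - x, y, shift x φ) = f (t, y, φ))
    (n : ℕ) (φ : Config d) :
    pointSum f (halfCube d n) φ =
      boxSum (fun k : Fin d → ℕ => shift fun i => (k i : ℝ)) (pointSum f (halfCube d 1)) n φ := by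
  have := pointSum_halfCube_mul hf hcov one_pos n φ
  simpa [boxSum] using this

theorem measurePreserving_shift {Q : Measure (Config d)} (hQ : IsStationaryLaw Q)
    (x : Fin d → ℝ) : MeasurePreserving (shift x) Q Q :=
  ⟨measurable_shift x, hQ x⟩

theorem lintegral_pointSum_halfCube_mul (hf : Measurable f)
    (hcov : ∀ (t x : Fin d → ℝ) (y : ℝ) (φ : Config d), f (t - x, y, shift x φ) = f (t, y, φ))
    {Q : Measure (Config d)} (hQ : IsStationaryLaw Q) {s : ℝ} (hs : 0 < s) (m : ℕ) :
    ∫⁻ φ, pointSum f (halfCube d (m * s)) φ ∂Q =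
      (m : ℝ≥0∞) ^ d * ∫⁻ φ, pointSum f (halfCube d s) φ ∂Q := by
  simp only [pointSum_halfCube_mul hf hcov hs m]
  exact lintegral_boxSum (S := fun k => shift fun i => (k i : ℝ) * s)
    (fun k => measurePreserving_shift hQ _) (measurable_pointSum hf (measurableSet_halfCube d s)) m

/-- The boundary of the unit cube carries no mass in the mean: the closed unit cube is contained in
`(n + 1) ^ d` cubes of side `1 / n`, of which `n ^ d` tile the half-open unit cube. -/
theorem lintegral_pointSum_Icc (hf : Measurable f)
    (hcov : ∀ (t x : Fin d → ℝ) (y : ℝ) (φ : Config d), f (t - x, y, shift x φ) = f (t, y, φ))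
    {Q : Measure (Config d)} (hQ : IsStationaryLaw Q) :
    ∫⁻ φ, pointSum f (Icc 0 1) φ ∂Q = ∫⁻ φ, pointSum f (halfCube d 1) φ ∂Q := by
  refine le_antisymm ?_ (lintegral_mono fun φ => pointSum_mono hf (measurableSet_halfCube d 1)
    measurableSet_Icc (fun t ht => ?_) φ)
  · have hlim := ENNReal.Tendsto.mul_const (b := ∫⁻ φ, pointSum f (halfCube d 1) φ ∂Q)
      (tendsto_ratio_pow d 1) (Or.inl one_ne_zero)
    rw [one_mul] at hlim
    refine ge_of_tendsto hlim ?_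
    filter_upwards [eventually_ge_atTop 1] with n hn
    have hn0 : (0 : ℝ) < n := by exact_mod_cast hn
    have hs : (0 : ℝ) < (n : ℝ)⁻¹ := inv_pos.2 hn0
    have h1 := lintegral_pointSum_halfCube_mul hf hcov hQ hs n
    rw [mul_inv_cancel₀ hn0.ne'] at h1
    rw [h1, div_eq_mul_inv, mul_pow, mul_assoc, ← mul_assoc (_⁻¹ ^ d), ← ENNReal.inv_pow,
      ENNReal.inv_mul_cancel (natCast_pow_ne_zero hn d) (natCast_pow_ne_top n d), one_mul,
      ← lintegral_pointSum_halfCube_mul hf hcov hQ hs (n + 1)]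
    refine lintegral_mono fun φ => pointSum_mono hf measurableSet_Icc (measurableSet_halfCube d _)
      (fun t ht => mem_halfCube.2 fun i => ⟨ht.1 i, (ht.2 i).trans_lt ?_⟩) φ
    push_cast
    rw [add_mul, mul_inv_cancel₀ hn0.ne', Pi.one_apply]
    linarith
  · rw [mem_halfCube] at ht
    exact ⟨fun i => (ht i).1, fun i => (ht i).2.le⟩

theorem lintegral_pointSum_lt_top (hf : Measurable f) (Q : Measure (Config d)) [SFinite Q]
    (hint : Integrable f (campbellMeasure Q)) : ∫⁻ φ, pointSum f (Icc 0 1) φ ∂Q < ∞ := by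
  have h := hint.lintegral_lt_top
  have hF : Measurable fun q : Config d × ((Fin d → ℝ) × ℝ) =>
      ENNReal.ofReal (f (q.2.1, q.2.2, q.1)) := (hf.comp (by fun_prop)).ennreal_ofReal
  rw [campbellMeasure, lintegral_map hf.ennreal_ofReal (by fun_prop),
    Measure.lintegral_compProd hF] at h
  refine lt_of_le_of_lt (lintegral_mono fun φ => ?_) h
  rw [pointSum_eq_lintegral hf measurableSet_Icc, Kernel.restrict_apply]
  exact le_rfl

/-- The upper spatial density `limsup n^{-d} ∑_{(t,y) ∈ φ, t ∈ [0,n)^d} f(t, y, φ)`. -/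
noncomputable def upperDensity (f : (Fin d → ℝ) × ℝ × Config d → ℝ) (φ : Config d) : ℝ≥0∞ :=
  limsup (fun n : ℕ => pointSum f (halfCube d n) φ / (n : ℝ≥0∞) ^ d) atTop

theorem measurable_upperDensity (hf : Measurable f) : Measurable (upperDensity f) :=
  Measurable.limsup fun n => (measurable_pointSum hf (measurableSet_halfCube d n)).div_const _

/-- Translating `[0,n)^d` by a vector `x` with non-negative coordinates at most `m` stays inside
`[0,n+m)^d`, so such shifts do not increase the upper density. -/
theorem upperDensity_shift_le (hf : Measurable f)
    (hcov : ∀ (t x : Fin d → ℝ) (y : ℝ) (φ : Config d), f (t - x, y, shift x φ) = f (t, y, φ))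
    {x : Fin d → ℝ} (hx : 0 ≤ x) (φ : Config d) :
    upperDensity f (shift x φ) ≤ upperDensity f φ := by
  obtain ⟨m, hm⟩ := exists_nat_ge ‖x‖
  refine le_of_forall_gt_imp_ge_of_dense fun c hc => ?_
  have hlim := ENNReal.Tendsto.const_mul (a := c) (tendsto_ratio_pow d m) (Or.inl one_ne_zero)
  rw [mul_one] at hlim
  rw [← hlim.limsup_eq]
  refine limsup_le_limsup ?_
  have hev : ∀ᶠ n : ℕ in atTop, pointSum f (halfCube d n) φ / (n : ℝ≥0∞) ^ d < c :=
    eventually_lt_of_limsup_lt hc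
  filter_upwards [(tendsto_add_atTop_nat m).eventually hev, eventually_ge_atTop 1] with n hn hn1
  have h1 : pointSum f (halfCube d (n + m : ℕ)) φ ≤ c * ((n + m : ℕ) : ℝ≥0∞) ^ d :=
    (ENNReal.div_le_iff (natCast_pow_ne_zero (by omega) d) (natCast_pow_ne_top _ d)).1 hn.le
  rw [pointSum_shift hf hcov (measurableSet_halfCube d _), div_eq_mul_inv _ (n : ℝ≥0∞), mul_pow,
    ← ENNReal.inv_pow, ← mul_assoc, div_eq_mul_inv]
  gcongr
  refine le_trans (pointSum_mono hf (measurable_sub_const x (measurableSet_halfCube d _))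
    (measurableSet_halfCube d _) (fun t ht => mem_halfCube.2 fun i => ?_) φ) h1
  have h2 := mem_halfCube.1 ht i
  have h3 : x i ≤ m := (le_abs_self _).trans ((norm_le_pi_norm x i).trans hm)
  have h4 : 0 ≤ x i := hx i
  simp only [Pi.sub_apply] at h2
  push_cast
  constructor <;> linarith

/-- Under an ergodic stationary law, a sublevel set of a function which does not increase under
non-negative shifts has probability zero or one. Such a set need not be invariant, but the union of
its preimages under the shifts by `(m, …, m)` is strictly invariant and has the same probability. -/
theorem measure_sublevel_eq_zero_or_one {Q : Measure (Config d)} (hQ : IsStationaryLaw Q)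
    (hE : IsErgodicLaw Q) {ℓ : Config d → ℝ≥0∞} (hℓ : Measurable ℓ)
    (hle : ∀ x : Fin d → ℝ, 0 ≤ x → ∀ φ, ℓ (shift x φ) ≤ ℓ φ) (c : ℝ≥0∞) :
    Q {φ | ℓ φ ≤ c} = 0 ∨ Q {φ | ℓ φ ≤ c} = 1 := by
  set A : Set (Config d) := {φ | ℓ φ ≤ c} with hA
  have hAm : MeasurableSet A := measurableSet_le hℓ measurable_const
  let B : ℕ → Set (Config d) := fun m => shift (fun _ => (m : ℝ)) ⁻¹' A
  have hstep : ∀ (x y : Fin d → ℝ) (φ : Config d), x ≤ y → shift x φ ∈ A → shift y φ ∈ A := by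
    intro x y φ hxy h
    have := hle (y - x) (sub_nonneg.2 hxy) (shift x φ)
    rw [← shift_add, sub_add_cancel] at this
    exact this.trans h
  have hmono : Monotone B := fun m m' hm φ h =>
    hstep _ _ φ (fun _ => Nat.cast_le.2 hm) h
  have hsub : ∀ (x : Fin d → ℝ) (φ : Config d), φ ∈ ⋃ m, B m → shift x φ ∈ ⋃ m, B m := by
    intro x φ h
    obtain ⟨m, hm⟩ := mem_iUnion.1 h
    obtain ⟨l, hl⟩ := exists_nat_ge ‖x‖
    refine mem_iUnion.2 ⟨m + l, ?_⟩
    change shift _ (shift x φ) ∈ A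
    rw [← shift_add]
    refine hstep _ _ φ (fun i => ?_) hm
    have := (neg_le_abs (x i)).trans ((norm_le_pi_norm x i).trans hl)
    simp only [Pi.add_apply, Nat.cast_add]
    linarith
  have hinv : ∀ x : Fin d → ℝ, shift x ⁻¹' (⋃ m, B m) = ⋃ m, B m := by
    intro x
    refine Subset.antisymm (fun φ h => ?_) fun φ h => hsub x φ h
    have h0 : shift (0 : Fin d → ℝ) φ = φ := by
      refine Subtype.ext ?_
      change φ.1.map _ = φ.1
      simp
    have := hsub (-x) _ h
    rwa [← shift_add, neg_add_cancel, h0] at this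
  have hmeas : Q (⋃ m, B m) = Q A := by
    rw [hmono.measure_iUnion]
    have : ∀ m, Q (B m) = Q A := fun m =>
      (measurePreserving_shift hQ _).measure_preimage hAm.nullMeasurableSet
    simp [this]
  have := hE (⋃ m, B m) (MeasurableSet.iUnion fun m => measurable_shift _ hAm) hinv
  rwa [hmeas] at this

/-- It suffices to bound the function by its mean almost surely, which follows from the zero-one law
for the sublevel sets at levels above the mean. -/
theorem ae_eq_lintegral_of_shift_le {Q : Measure (Config d)} [IsProbabilityMeasure Q]
    (hQ : IsStationaryLaw Q) (hE : IsErgodicLaw Q) {ℓ : Config d → ℝ≥0∞} (hℓ : Measurable ℓ)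
    (hle : ∀ x : Fin d → ℝ, 0 ≤ x → ∀ φ, ℓ (shift x φ) ≤ ℓ φ) (hfin : ∫⁻ φ, ℓ φ ∂Q ≠ ∞) :
    ∀ᵐ φ ∂Q, ℓ φ = ∫⁻ φ', ℓ φ' ∂Q := by
  set e := ∫⁻ φ, ℓ φ ∂Q with he
  have hc : ∀ c, e < c → ∀ᵐ φ ∂Q, ℓ φ ≤ c := by
    intro c hec
    rcases measure_sublevel_eq_zero_or_one hQ hE hℓ hle c with h | h
    · -- otherwise `ℓ > c` almost surely, contradicting `∫ ℓ = e < c`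
      refine absurd ?_ hec.not_ge
      have h1 : ∀ᵐ φ ∂Q, c ≤ ℓ φ := by
        filter_upwards [measure_eq_zero_iff_ae_notMem.1 h] with φ hφ
        exact (not_le.1 hφ).le
      simpa using lintegral_mono_ae h1
    · exact (prob_compl_eq_zero_iff (measurableSet_le hℓ measurable_const)).2 h
  have hle' : ∀ᵐ φ ∂Q, ℓ φ ≤ e := by
    have hall : ∀ᵐ φ ∂Q, ∀ m : ℕ, ℓ φ ≤ e + ((m : ℝ≥0∞) + 1)⁻¹ := ae_all_iff.2 fun m =>
      hc _ (ENNReal.lt_add_right hfin (by simp))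
    filter_upwards [hall] with φ hφ
    have hlim : Tendsto (fun m : ℕ => e + ((m : ℝ≥0∞) + 1)⁻¹) atTop (𝓝 (e + 0)) := by
      have := (tendsto_add_atTop_iff_nat 1).2 ENNReal.tendsto_inv_nat_nhds_zero
      exact Tendsto.const_add _ (by exact_mod_cast this)
    rw [add_zero] at hlim
    exact ge_of_tendsto' hlim hφ
  exact ae_eq_of_ae_le_of_lintegral_le hle' hfin aemeasurable_const (by simp [← he])

/-- Closed cubes may replace half-open ones, since `[0,n)^d ⊆ [0,n]^d ⊆ [0,n+1)^d`. -/
theorem tendsto_spatialAverage (hf : Measurable f) {φ : Config d} {e : ℝ≥0∞}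
    (h : Tendsto (fun n : ℕ => pointSum f (halfCube d n) φ / (n : ℝ≥0∞) ^ d) atTop (𝓝 e)) :
    Tendsto (fun n : ℕ => spatialAverage f n φ) atTop (𝓝 e) := by
  have hup := ENNReal.Tendsto.mul ((tendsto_add_atTop_iff_nat 1).2 h) (Or.inr ENNReal.one_ne_top)
    (tendsto_ratio_pow d 1) (Or.inl one_ne_zero)
  rw [mul_one] at hup
  refine tendsto_of_tendsto_of_tendsto_of_le_of_le h hup (fun n => ?_) fun n => ?_
  · refine ENNReal.div_le_div_right (pointSum_mono hf (measurableSet_halfCube d n)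
      measurableSet_Icc (fun t ht => ?_) φ) _
    rw [mem_halfCube] at ht
    exact ⟨fun i => (ht i).1, fun i => (ht i).2.le⟩
  · change _ ≤ pointSum f (halfCube d (n + 1 : ℕ)) φ / ((n + 1 : ℕ) : ℝ≥0∞) ^ d *
      (((n + 1 : ℕ) : ℝ≥0∞) / (n : ℝ≥0∞)) ^ d
    rw [div_eq_mul_inv _ (n : ℝ≥0∞), mul_pow, ← mul_assoc,
      ENNReal.div_mul_cancel (natCast_pow_ne_zero (by omega) d) (natCast_pow_ne_top _ d),
      ← ENNReal.inv_pow, ← div_eq_mul_inv]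
    refine ENNReal.div_le_div_right (pointSum_mono hf measurableSet_Icc
      (measurableSet_halfCube d _) (fun t ht => mem_halfCube.2 fun i =>
        ⟨ht.1 i, (ht.2 i).trans_lt ?_⟩) φ) _
    push_cast
    linarith

end PointSum

end MPP

theorem propositionA2 {d : ℕ} {Ω : Type*} [MeasurableSpace Ω]
    (P : Measure Ω) [IsProbabilityMeasure P]
    (Φ : Ω → MPP.Config d) (hΦ : Measurable Φ)
    (hstat : MPP.IsStationaryLaw (P.map Φ)) (herg : MPP.IsErgodicLaw (P.map Φ))
    (f : (Fin d → ℝ) × ℝ × MPP.Config d → ℝ)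
    (hf_meas : Measurable f) (hf_nonneg : ∀ q, 0 ≤ f q)
    (hf_cov : ∀ (t x : Fin d → ℝ) (y : ℝ) (φ : MPP.Config d),
      f (t - x, y, MPP.shift x φ) = f (t, y, φ))
    (hf_int : Integrable f (MPP.campbellMeasure (P.map Φ))) :
    Measurable (MPP.pointSum f (Icc 0 1)) ∧
    (∀ n : ℕ, Measurable (MPP.spatialAverage f n)) ∧
    (∫⁻ φ, MPP.pointSum f (Icc 0 1) φ ∂(P.map Φ)) < ∞ ∧
    ∀ᵐ φ ∂(P.map Φ), Tendsto (fun n : ℕ => MPP.spatialAverage f n φ) atTop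
      (𝓝 (∫⁻ φ', MPP.pointSum f (Icc 0 1) φ' ∂(P.map Φ))) := by
  have hprob : IsProbabilityMeasure (P.map Φ) :=
    Measure.isProbabilityMeasure_map hΦ.aemeasurable
  have hfin := MPP.lintegral_pointSum_lt_top hf_meas (P.map Φ) hf_int
  refine ⟨MPP.measurable_pointSum hf_meas measurableSet_Icc,
    fun n => (MPP.measurable_pointSum hf_meas measurableSet_Icc).div_const _, hfin, ?_⟩
  rw [MPP.lintegral_pointSum_Icc hf_meas hf_cov hstat] at hfin ⊢
  let S : (Fin d → ℕ) → MPP.Config d → MPP.Config d := fun k => MPP.shift fun i => (k i : ℝ)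
  have hS : ∀ k, MeasurePreserving (S k) (P.map Φ) (P.map Φ) := fun k =>
    MPP.measurePreserving_shift hstat _
  have hadd : ∀ a b φ, S (a + b) φ = S a (S b φ) := fun a b φ => by
    simp only [S, ← MPP.shift_add]
    congr 1
    ext i
    simp
  have hg := MPP.measurable_pointSum hf_meas (MPP.measurableSet_halfCube d 1)
  have hlim := MPP.ae_tendsto_boxSum hS hadd hg hfin.ne
  have hmean := MPP.lintegral_limsup_boxSum hS hadd hg hfin.ne
  simp only [S, ← MPP.pointSum_halfCube_eq_boxSum hf_meas hf_cov] at hlim hmean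
  have hconst := MPP.ae_eq_lintegral_of_shift_le hstat herg (MPP.measurable_upperDensity hf_meas)
    (fun x hx φ => MPP.upperDensity_shift_le hf_meas hf_cov hx φ) (hmean.trans_lt hfin).ne
  filter_upwards [hlim, hconst] with φ h1 h2
  refine MPP.tendsto_spatialAverage hf_meas ?_
  rw [← hmean]
  exact h2 ▸ h1
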